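/- **Theorem (convergence of the modified Strang splitting).** Let $X,Q$ be (real) Banach spaces, $T>0$, let $A\colon D(A)\subseteq X\to X$ be linear, and let $D\colon X\to Q$ be a bounded linear operator with a bounded linear right inverse $D^-\colon Q\to X$, $DD^-=\mathrm{id}_Q$ (so $D$ is onto). Put $X_0=\ker D$, $P_0=\mathrm{id}-D^-D$ and $A_0=P_0A|_{X_0}\colon D(A)\cap X_0\to X_0$. Consider $$\dot u-Au-f(u)+D^-\lambda=F,\qquad Du=G,\qquad u(0)=u_0\qquad\text{on }[0,T],$$ under the following assumptions. * $f\colon X\to X$ is twice Fréchet differentiable with locally bounded second derivative; the system has a (mild) solution $u\in C([0,T];X)$ with $f(u(t))\in D(A)$ for all $t\in[0,T]$, and $t\mapsto f(u(t))$ is twice continuously differentiable on $[0,T]$ with values in $X$. * $Du_0=G(0)$ and $u_0\in D(A)$. * $F\colon[0,T]\to X$ is continuous, $G\colon[0,T]\to Q$ is Lipschitz continuous, $D^-G(t)\in D(A)$ for all $t$, and $AD^-G$ is integrable on $[0,T]$. * $A_0$ generates an analytic ($C_0$-)semigroup on $X_0$. Here a (mild) solution on $[0,h]$ of the linear system $\dot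 v-Av+D^-\lambda=g$, $Dv=\gamma$, $v(0)=x$, is a function $v\in C([0,h];X)$ with $Dv=\gamma$ for which there is $\Lambda\colon[0,h]\to Q$ (the time integral of $\lambda$) such that $\int_0^tP_0v\,ds\in D(A)$ and $$v(t)+D^-\Lambda(t)=x+A\int_0^tP_0v(s)\,ds+\int_0^t\big(AD^-\gamma(s)+g(s)\big)\,ds,\qquad 0\le t\le h .$$ If $x$ is inconsistent with the constraint, this means that $x$ is replaced by $v(0)=P_0x+D^-\gamma(0)$. The function $u$ is a solution of the constrained system if it satisfies this with $h=T$, $g=F+f(u)$, $\gamma=G$, $x=u_0$. For a step size $\tau>0$ let $t_n=n\tau$, $F_n(s)=F(t_n+s)$, $G_n(s)=G(t_n+s)$. Given a correction $q_n\colon[0,\tau]\to X$, one step $u_n\mapsto u_{n+1}$ of the modified Strang splitting consists in solving successively 1. $\dot v_n-Av_n+D^-\lambda=F_n+q_n$, $Dv_n=G_n$ on $[0,\tfrac\tau2]$ with $v_n(0)=u_n$; 2. $\dot w_n=f(w_n)-q_n$ on $[0,\tau]$ with $w_n(0)=v_n(\tfrac\tau2)$; 3. $\dot v_n-Av_n+D^-\lambda=F_n+q_n$,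 $Dv_n=G_n$ on $[\tfrac\tau2,\tau]$ with (possibly inconsistent) initial value $w_n(\tau)$ at time $\tfrac\tau2$; and setting $u_{n+1}=v_n(\tau)$. Let $M$ be a constant. Then there are constants $C$ and $\tau_0>0$ such that the following holds for all $0<\tau\le\tau_0$, all $N$ with $N\tau\le T$, and all corrections $q_0,\dots,q_{N-1}$ which satisfy, for each $n<N$, * $q_n\in C^2([0,\tau];X)$, and $\|q_n^{(k)}(s)\|\le M$ for $k=0,1,2$ and $s\in[0,\tau]$; * (smoothness) for all $s\in[0,\tau]$, $\hat\psi_n(s):=q_n(s)-f(u(t_n+s))\in D(A)$ and $P_0\hat\psi_n(s)\in D(A_0)$ with $\|A_0P_0\hat\psi_n(s)\|\le M$; * (consistency) $\|Dq_n(0)-Df(u(t_n))\|\le M\tau$. The modified Strang splitting started at $u_0$ can be carried out for $N$ steps, and every sequence $u_0,u_1,\dots,u_N$ that it produces satisfies $$\|u(t_n)-u_n\|\le C\,\tau^2\,(1+|\log\tau|)\qquad\text{for all }0\le n\le N .$$ In particular, $C$ does not depend on $\tau$, $n$, $N$ or the particular corrections. -/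

import Mathlib

open Set Filter Topology

noncomputable section

/-! ### Analytic semigroups on real Banach spaces -/

section Semigroups

variable {E : Type*} [NormedAddCommGroup E] [NormedSpace ℝ E]

/-- Multiplication by the complex number `c` in the complexification `E × E` of the real space `E`,
where the pair `(x, y)` stands for `x + i y`. -/
def complexSMul (c : ℂ) (p : E × E) : E × E :=
  (c.re • p.1 - c.im • p.2, c.im • p.1 + c.re • p.2)

/-- `S` (restricted to `t ≥ 0`) is a strongly continuous semigroup of bounded linear operators. -/
structure IsC0Semigroup (S : ℝ → E →L[ℝ] E) : Prop where
  map_zero : S 0 = ContinuousLinearMap.id ℝ E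
  map_add : ∀ s t : ℝ, 0 ≤ s → 0 ≤ t → S (s + t) = (S s).comp (S t)
  continuousOn : ∀ x : E, ContinuousOn (fun t => S t x) (Ici 0)

/-- `B` is the infinitesimal generator of `S`: a vector `x` lies in the domain of `B` with
`B x = y` if and only if `(S h x - x) / h` converges to `y` as `h` tends to `0` from the right. -/
def IsGeneratorOf (B : E →ₗ.[ℝ] E) (S : ℝ → E →L[ℝ] E) : Prop :=
  ∀ x y : E, (x, y) ∈ B.graph ↔
    Tendsto (fun h : ℝ => h⁻¹ • (S h x - x)) (𝓝[>] 0) (𝓝 y)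

/-- The open sector of half-angle `θ` around the positive real axis. -/
def openSector (θ : ℝ) : Set ℂ := {z : ℂ | z ≠ 0 ∧ |z.arg| < θ}

/-- The semigroup `S` on the real space `E` is analytic: on the complexification `E × E` it extends
to a holomorphic semigroup `R` of bounded complex linear operators on an open sector around the
positive real axis, with `R z p → p` as `z → 0` in the sector. -/
def IsAnalyticSemigroup (S : ℝ → E →L[ℝ] E) : Prop :=
  ∃ θ : ℝ, 0 < θ ∧ θ ≤ Real.pi / 2 ∧ ∃ R : ℂ → (E × E →L[ℝ] E × E),
    (∀ z ∈ openSector θ, ∀ (c : ℂ) (p : E × E),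
      R z (complexSMul c p) = complexSMul c (R z p)) ∧
    (∀ t : ℝ, 0 < t → ∀ x : E, R (t : ℂ) (x, 0) = (S t x, 0)) ∧
    (∀ z ∈ openSector θ, ∀ w ∈ openSector θ, R (z + w) = (R z).comp (R w)) ∧
    (∀ z ∈ openSector θ, ∀ p : E × E, ∃ p' : E × E,
      Tendsto (fun h : ℂ => complexSMul h⁻¹ (R (z + h) p - R z p)) (𝓝[≠] 0) (𝓝 p')) ∧
    (∀ p : E × E, Tendsto (fun z => R z p) (𝓝[openSector θ] 0) (𝓝 p))

/-- The (in general unbounded) operator `B` generates an analytic semigroup. -/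
def GeneratesAnalyticSemigroup (B : E →ₗ.[ℝ] E) : Prop :=
  ∃ S : ℝ → E →L[ℝ] E, IsC0Semigroup S ∧ IsGeneratorOf B S ∧ IsAnalyticSemigroup S

open Classical in
/-- The value `B x` of a partially defined operator, with value `0` outside the domain. -/
def applyPartial (B : E →ₗ.[ℝ] E) (x : E) : E :=
  if h : x ∈ B.domain then B ⟨x, h⟩ else 0

end Semigroups

/-! ### The constrained evolution equation -/

/-- The data of the constrained system
`u' - A u - f(u) + D⁻ λ = F`, `D u = G`, `u(0) = u₀` on `[0, T]`. Here `A` is a linear operator with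
domain `A.domain`, `D` is the (bounded) constraint operator and `Dinv` is its (bounded) right
inverse `D⁻`. In particular `D` is onto, and its kernel is closed. -/
structure ConstrainedSystem (X Q : Type*) [NormedAddCommGroup X] [NormedSpace ℝ X]
    [NormedAddCommGroup Q] [NormedSpace ℝ Q] where
  A : X →ₗ.[ℝ] X
  D : X →L[ℝ] Q
  Dinv : Q →L[ℝ] X
  D_Dinv : ∀ r : Q, D (Dinv r) = r
  f : X → X
  F : ℝ → X
  G : ℝ → Q
  u₀ : X
  T : ℝ

namespace ConstrainedSystem

variable {X Q : Type*} [NormedAddCommGroup X] [NormedSpace ℝ X]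
  [NormedAddCommGroup Q] [NormedSpace ℝ Q] (P : ConstrainedSystem X Q)

/-- The kernel `X₀` of the constraint operator. -/
def X₀ : Submodule ℝ X := LinearMap.ker (P.D : X →ₗ[ℝ] Q)

/-- The projection `P₀ = id - D⁻ D`. -/
def P₀ : X →L[ℝ] X := ContinuousLinearMap.id ℝ X - P.Dinv.comp P.D

theorem P₀_mem (x : X) : P.P₀ x ∈ P.X₀ := by
  simp [X₀, P₀, P.D_Dinv]

/-- The operator `A₀ = P₀ A|_{X₀}` on `X₀`, with domain `D(A) ∩ X₀`. -/
def A₀ : P.X₀ →ₗ.[ℝ] P.X₀ where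
  domain := P.A.domain.comap P.X₀.subtype
  toFun :=
    { toFun := fun x => ⟨P.P₀ (P.A ⟨(x : P.X₀), x.2⟩), P.P₀_mem _⟩
      map_add' := by
        intro x y
        apply Subtype.ext
        have h : (⟨((x + y : P.A.domain.comap P.X₀.subtype) : P.X₀), (x + y).2⟩ : P.A.domain)
          = ⟨(x : P.X₀), x.2⟩ + ⟨(y : P.X₀), y.2⟩ := rfl
        change P.P₀ (P.A _) = P.P₀ (P.A _) + P.P₀ (P.A _)
        rw [h, P.A.map_add, map_add]
      map_smul' := by
        intro c x
        apply Subtype.ext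
        have h : (⟨((c • x : P.A.domain.comap P.X₀.subtype) : P.X₀), (c • x).2⟩ : P.A.domain)
          = c • ⟨(x : P.X₀), x.2⟩ := rfl
        change P.P₀ (P.A _) = c • P.P₀ (P.A _)
        rw [h, P.A.map_smul, map_smul] }

/-- `v : [0, h] → X` solves the linear constrained system
`v' - A v + D⁻ λ = g`, `D v = γ`, `v(0) = x` on `[0, h]`, in the time-integrated (mild) sense:
`v` is continuous, satisfies the constraint, and
`v(t) + D⁻ Λ(t) = x + A ∫₀ᵗ P₀ v + ∫₀ᵗ (A D⁻ γ + g)` on `[0, h]`.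
Note that `v = P₀ v + D⁻ γ`. The function `Λ` is the time integral of the multiplier `λ`. Nothing is
demanded of `Λ(0)`: if `x` violates the constraint, `λ` has an impulse at time `0` which replaces
`x` by the consistent value `v(0) = P₀ x + D⁻ γ(0)`; if `D x = γ(0)`, then `Λ(0) = 0` and
`v(0) = x`. -/
def IsSolution (h : ℝ) (g : ℝ → X) (γ : ℝ → Q) (x : X) (v : ℝ → X) : Prop :=
  ContinuousOn v (Icc 0 h) ∧
  (∀ t ∈ Icc 0 h, P.D (v t) = γ t) ∧
  ∃ Λ : ℝ → Q, ∀ t ∈ Icc 0 h,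
    (∫ s in (0 : ℝ)..t, P.P₀ (v s)) ∈ P.A.domain ∧
    v t + P.Dinv (Λ t) = x + applyPartial P.A (∫ s in (0 : ℝ)..t, P.P₀ (v s))
      + ∫ s in (0 : ℝ)..t, (applyPartial P.A (P.Dinv (γ s)) + g s)

/-- The standing assumptions on the system and on its exact solution `u`. -/
structure Assumptions (u : ℝ → X) : Prop where
  T_pos : 0 < P.T
  /- the nonlinearity and the exact solution -/
  f_diff : Differentiable ℝ P.f
  f_diff_two : Differentiable ℝ (fderiv ℝ P.f)
  f_second_locally_bounded :
    ∀ x : X, ∃ K : ℝ, ∀ᶠ y in 𝓝 x, ‖fderiv ℝ (fderiv ℝ P.f) y‖ ≤ K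
  u_solution : P.IsSolution P.T (fun t => P.F t + P.f (u t)) P.G P.u₀ u
  fu_mem : ∀ t ∈ Icc 0 P.T, P.f (u t) ∈ P.A.domain
  fu_smooth : ContDiffOn ℝ 2 (fun t => P.f (u t)) (Icc 0 P.T)
  /- the initial value -/
  u₀_consistent : P.D P.u₀ = P.G 0
  u₀_mem : P.u₀ ∈ P.A.domain
  /- the right-hand sides -/
  F_continuous : ContinuousOn P.F (Icc 0 P.T)
  G_lipschitz : ∃ K, LipschitzOnWith K P.G (Icc 0 P.T)
  DinvG_mem : ∀ t ∈ Icc 0 P.T, P.Dinv (P.G t) ∈ P.A.domain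
  ADinvG_integrable :
    MeasureTheory.IntegrableOn (fun t => applyPartial P.A (P.Dinv (P.G t))) (Icc 0 P.T)
  /- the diffusion operator -/
  A₀_generates : GeneratesAnalyticSemigroup P.A₀

/-- Conditions on the correction `q = q_n` of the step from `t = t_n` to `t + τ`, with a constant
`M`: it is twice continuously differentiable with bounds `M`, it satisfies the smoothness condition
`q(s) - f(u(t + s)) ∈ D(A)` (with `P₀ (q(s) - f(u(t + s))) ∈ D(A₀)` and `A₀ P₀ (q(s) - f(u(t + s)))`
bounded by `M`), and the consistency condition `D q(0) = D f(u(t)) + O(τ)`. -/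
structure IsCorrection (u : ℝ → X) (M τ t : ℝ) (q : ℝ → X) : Prop where
  contDiffOn : ContDiffOn ℝ 2 q (Icc 0 τ)
  bound : ∀ k : ℕ, k ≤ 2 → ∀ s ∈ Icc 0 τ, ‖iteratedDerivWithin k q (Icc 0 τ) s‖ ≤ M
  smooth : ∀ s ∈ Icc 0 τ, q s - P.f (u (t + s)) ∈ P.A.domain
  smooth_P₀ : ∀ s ∈ Icc 0 τ, P.P₀ (q s - P.f (u (t + s))) ∈ P.A.domain
  bound_P₀ : ∀ s ∈ Icc 0 τ,
    ‖P.P₀ (applyPartial P.A (P.P₀ (q s - P.f (u (t + s)))))‖ ≤ M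
  consistent : ‖P.D (q 0) - P.D (P.f (u t))‖ ≤ M * τ

/-- One step `x ↦ y` of the modified Strang splitting with step size `τ` starting at time `t`:
the linear constrained system on `[0, τ/2]`, then the nonlinear equation `w' = f(w) - q` on
`[0, τ]`, then the linear constrained system on `[τ/2, τ]` (written on `[0, τ/2]`, with shifted
data). -/
def IsStrangStep (τ t : ℝ) (q : ℝ → X) (x y : X) : Prop :=
  ∃ v w v' : ℝ → X,
    P.IsSolution (τ / 2) (fun s => P.F (t + s) + q s) (fun s => P.G (t + s)) x v ∧
    w 0 = v (τ / 2) ∧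
    (∀ s ∈ Icc 0 τ, HasDerivWithinAt w (P.f (w s) - q s) (Icc 0 τ) s) ∧
    P.IsSolution (τ / 2) (fun s => P.F (t + (τ / 2 + s)) + q (τ / 2 + s))
      (fun s => P.G (t + (τ / 2 + s))) (w τ) v' ∧
    y = v' (τ / 2)

/-- `U 0, …, U N` are the approximations produced by `N` steps of the modified Strang splitting with
step size `τ` and corrections `q 0, …, q (N - 1)`, starting from `u₀`. -/
def IsStrangSplitting (τ : ℝ) (N : ℕ) (q : ℕ → ℝ → X) (U : ℕ → X) : Prop :=
  U 0 = P.u₀ ∧ ∀ n < N, P.IsStrangStep τ (n * τ) (q n) (U n) (U (n + 1))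

end ConstrainedSystem

end

/-!
The projection `P₀` removes the multiplier from the linear constrained system: its solutions are
`v = z + D⁻ γ`, where `z = P₀ v` is given by the variation of constants formula for the semigroup
`S` generated by `A₀` on `X₀` (`IsSolution.proj₀_eq`, `exists_isSolution`). Since the exact solution
and the numerical one satisfy the same constraint, their difference `e` lies in `X₀`, and the data
`A D⁻ G + F` drop out of it. With `φ = P₀ (q - f(u))`, one step of the splitting turns `e` into

  `S(τ) e + (∫₀^τ S(τ - s) φ(s) ds - S(τ/2) ∫₀^τ φ(s) ds)`
    `+ S(τ/2) P₀ ∫₀^τ (f(w(s)) - f(u(t + s))) ds`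

(`UniformBounds.error_recursion`).

The bracket is a quadrature error `d`. As `φ` is Lipschitz continuous with `A₀ φ` bounded, `d` is
`O(τ²)`. Analyticity makes `S` Lipschitz continuous in operator norm on `[t, T]` with constant
`O(1 / t)` (`IsAnalyticSemigroup.exists_norm_sub_le`), so that after smoothing `S(t) d` is
`O(τ³ / t)` (`IsExtendedC0Semigroup.norm_quadrature_error_le`).

For the last term the midpoint rule applies to `f(w)` and to `f(u)`, which leaves
`w(τ/2) - u(t + τ/2)`. This is `O(‖e‖ + τ²)` because the smoothness and the consistency of the
correction make `(S(τ/2 - s) - 1) φ(s)` and the component of `q - f(u)` in the range of `D⁻` both of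
order `τ` (`UniformBounds.norm_midpoint_sub_le`).

Summing up, the quadrature errors contribute `O(τ²) (1 + ∑ 1 / j) = O(τ² (1 + |log τ|))` and the
remaining terms are absorbed by a discrete Gronwall inequality
(`IsExtendedC0Semigroup.norm_le_of_recursion`). The local bounds on `f` are only available near the
exact solution; the error bound, being `O(τ)`, keeps the numerical solution there, and with it each
further step exists (`UniformBounds.convergence`).
-/

noncomputable section

/-! ### Strongly continuous semigroups and the variation of constants formula -/

section SemigroupTheory

variable {E : Type*} [NormedAddCommGroup E] [NormedSpace ℝ E]

theorem hasDerivWithinAt_Ici_iff_tendsto {f : ℝ → E} {f' : E} {x : ℝ} :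
    HasDerivWithinAt f f' (Ici x) x ↔
      Tendsto (fun η : ℝ => η⁻¹ • (f (x + η) - f x)) (𝓝[>] 0) (𝓝 f') := by
  have hm : map (fun η : ℝ => x + η) (𝓝[>] 0) = 𝓝[>] x := by simp
  rw [← hasDerivWithinAt_Ioi_iff_Ici, hasDerivWithinAt_iff_tendsto_slope' self_notMem_Ioi, ← hm,
    tendsto_map'_iff]
  refine tendsto_congr fun η => ?_
  simp [slope_def_module]

/-- A strongly continuous semigroup on `[0, ∞)`, continued to negative times by the identity. This
normalization makes `(t, x) ↦ S t x` continuous on the whole of `ℝ × E`. -/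
structure IsExtendedC0Semigroup (S : ℝ → E →L[ℝ] E) : Prop extends IsC0Semigroup S where
  map_nonpos : ∀ t ≤ 0, S t = ContinuousLinearMap.id ℝ E

theorem IsC0Semigroup.extend {S : ℝ → E →L[ℝ] E} (hS : IsC0Semigroup S) :
    IsExtendedC0Semigroup (fun t => S (max t 0)) where
  map_zero := by simp [hS.map_zero]
  map_add s t hs ht := by
    simp only [max_eq_left hs, max_eq_left ht, max_eq_left (add_nonneg hs ht)]
    exact hS.map_add s t hs ht
  continuousOn x := (hS.continuousOn x).congr fun t ht => by simp [max_eq_left (mem_Ici.1 ht)]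
  map_nonpos t ht := by simp [max_eq_right ht, hS.map_zero]

theorem IsGeneratorOf.extend {B : E →ₗ.[ℝ] E} {S : ℝ → E →L[ℝ] E} (hB : IsGeneratorOf B S) :
    IsGeneratorOf B (fun t => S (max t 0)) := by
  intro x y
  rw [hB x y]
  refine tendsto_congr' ?_
  filter_upwards [self_mem_nhdsWithin] with h hh
  rw [max_eq_left (le_of_lt hh)]

/-- The convolution `∫₀ᵗ S (t - s) h(s) ds` of the variation of constants formula. -/
def duhamel (S : ℝ → E →L[ℝ] E) (h : ℝ → E) (t : ℝ) : E :=
  ∫ s in (0 : ℝ)..t, S (t - s) (h s)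

namespace IsExtendedC0Semigroup

variable {S : ℝ → E →L[ℝ] E}

theorem map_add_apply (hS : IsExtendedC0Semigroup S) {s t : ℝ} (hs : 0 ≤ s) (ht : 0 ≤ t) (x : E) :
    S (s + t) x = S s (S t x) := by
  rw [hS.map_add s t hs ht]; rfl

theorem map_zero_apply (hS : IsExtendedC0Semigroup S) (x : E) : S 0 x = x := by
  rw [hS.map_zero]; rfl

theorem continuous_apply (hS : IsExtendedC0Semigroup S) (x : E) : Continuous fun t => S t x := by
  have h : (fun t => S t x) = fun t => S (max t 0) x := by
    funext t
    rcases le_total t 0 with ht | ht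
    · rw [max_eq_right ht, hS.map_nonpos t ht, hS.map_zero]
    · rw [max_eq_left ht]
  rw [h]
  exact (hS.continuousOn x).comp_continuous (by fun_prop) fun t => mem_Ici.2 (le_max_right t 0)

variable [CompleteSpace E]

theorem exists_bound (hS : IsExtendedC0Semigroup S) (T : ℝ) :
    ∃ K : ℝ, 1 ≤ K ∧ ∀ t ≤ T, ‖S t‖ ≤ K := by
  obtain ⟨K, hK⟩ := banach_steinhaus (g := fun t : Icc (0 : ℝ) T => S t) fun x => by
    obtain ⟨C, hC⟩ := isCompact_Icc.exists_bound_of_continuousOn (s := Icc (0 : ℝ) T)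
      (hS.continuous_apply x).continuousOn
    exact ⟨C, fun t => hC t t.2⟩
  refine ⟨max K 1, le_max_right _ _, fun t ht => ?_⟩
  rcases le_total t 0 with h0 | h0
  · rw [hS.map_nonpos t h0]
    exact ContinuousLinearMap.norm_id_le.trans (le_max_right _ _)
  · exact (hK ⟨t, h0, ht⟩).trans (le_max_left _ _)

theorem continuous_uncurry (hS : IsExtendedC0Semigroup S) :
    Continuous fun p : ℝ × E => S p.1 p.2 := by
  rw [continuous_iff_continuousAt]
  rintro ⟨t, x⟩
  obtain ⟨K, -, hK⟩ := hS.exists_bound (t + 1)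
  have hev : ∀ᶠ p : ℝ × E in 𝓝 (t, x), ‖S p.1‖ ≤ K := by
    have : ∀ᶠ s : ℝ in 𝓝 t, s ≤ t + 1 := eventually_le_nhds (by linarith)
    filter_upwards [(continuous_fst.tendsto (t, x)).eventually this] with p hp using hK _ hp
  have h1 : Tendsto (fun p : ℝ × E => K * ‖p.2 - x‖ + ‖S p.1 x - S t x‖) (𝓝 (t, x)) (𝓝 0) := by
    have hc : Continuous fun p : ℝ × E => K * ‖p.2 - x‖ + ‖S p.1 x - S t x‖ := by
      have h2 := (hS.continuous_apply x).comp (continuous_fst (X := ℝ) (Y := E))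
      exact (continuous_const.mul (continuous_snd.sub continuous_const).norm).add
        (h2.sub continuous_const).norm
    simpa using hc.tendsto (t, x)
  refine tendsto_iff_norm_sub_tendsto_zero.2 (squeeze_zero' (Eventually.of_forall fun _ =>
    norm_nonneg _) ?_ h1)
  filter_upwards [hev] with p hp
  calc ‖S p.1 p.2 - S t x‖ = ‖S p.1 (p.2 - x) + (S p.1 x - S t x)‖ := by
        rw [map_sub]; congr 1; abel
    _ ≤ ‖S p.1 (p.2 - x)‖ + ‖S p.1 x - S t x‖ := norm_add_le _ _
    _ ≤ K * ‖p.2 - x‖ + ‖S p.1 x - S t x‖ := by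
        gcongr; exact (S p.1).le_of_opNorm_le hp _

theorem intervalIntegrable_apply (hS : IsExtendedC0Semigroup S) {h : ℝ → E} {a b : ℝ} (t : ℝ)
    (hh : IntervalIntegrable h MeasureTheory.volume a b) :
    IntervalIntegrable (fun s => S (t - s) (h s)) MeasureTheory.volume a b := by
  obtain ⟨K, -, hK⟩ := hS.exists_bound (t - min a b)
  rw [intervalIntegrable_iff] at hh ⊢
  refine (hh.norm.const_mul K).mono' ?_ ?_
  · exact hS.continuous_uncurry.comp_aestronglyMeasurable
      ((by fun_prop : Continuous fun s : ℝ => t - s).aestronglyMeasurable.prodMk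
        hh.aestronglyMeasurable)
  · refine (MeasureTheory.ae_restrict_mem measurableSet_uIoc).mono fun s hs => ?_
    exact (S (t - s)).le_of_opNorm_le (hK _ (by linarith [hs.1])) _

theorem continuousOn_duhamel (hS : IsExtendedC0Semigroup S) {h : ℝ → E} {T : ℝ} (hT : 0 ≤ T)
    (hh : IntervalIntegrable h MeasureTheory.volume 0 T) :
    ContinuousOn (duhamel S h) (Icc 0 T) := by
  obtain ⟨K, -, hK⟩ := hS.exists_bound T
  -- for `s > t` the operator `S (t - s)` is the identity
  have heq : ∀ t ∈ Icc 0 T,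
      duhamel S h t = (∫ s in (0 : ℝ)..T, S (t - s) (h s)) - ∫ s in t..T, h s := by
    intro t ht
    have h0 : IntervalIntegrable h MeasureTheory.volume 0 t :=
      hh.mono_set (by rw [uIcc_of_le ht.1, uIcc_of_le hT]; exact Icc_subset_Icc_right ht.2)
    have h1 : IntervalIntegrable h MeasureTheory.volume t T :=
      hh.mono_set (by rw [uIcc_of_le ht.2, uIcc_of_le hT]; exact Icc_subset_Icc_left ht.1)
    rw [← intervalIntegral.integral_add_adjacent_intervals (hS.intervalIntegrable_apply t h0)
      (hS.intervalIntegrable_apply t h1), duhamel, eq_sub_iff_add_eq]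
    congr 1
    refine intervalIntegral.integral_congr fun s hs => ?_
    rw [uIcc_of_le ht.2] at hs
    simp [hS.map_nonpos (t - s) (by linarith [hs.1])]
  refine ContinuousOn.congr (f := fun t => (∫ s in (0 : ℝ)..T, S (t - s) (h s)) - ∫ s in t..T, h s)
    ?_ heq
  refine ContinuousOn.sub ?_ ?_
  · intro t ht
    refine intervalIntegral.continuousWithinAt_of_dominated_interval (bound := fun s => K * ‖h s‖)
      ?_ ?_ (hh.norm.const_mul K) ?_
    · exact Eventually.of_forall fun t =>
        (intervalIntegrable_iff.1 (hS.intervalIntegrable_apply t hh)).aestronglyMeasurable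
    · filter_upwards [self_mem_nhdsWithin] with t ht
      refine Eventually.of_forall fun s hs => ?_
      rw [uIoc_of_le hT] at hs
      exact (S (t - s)).le_of_opNorm_le (hK _ (by linarith [hs.1, ht.2])) _
    · refine Eventually.of_forall fun s _ => ?_
      exact ((hS.continuous_apply (h s)).comp
        (by fun_prop : Continuous fun t : ℝ => t - s)).continuousWithinAt
  · have := intervalIntegral.continuousOn_primitive_interval_left (μ := MeasureTheory.volume)
      (f := h) (a := 0) (b := T) (by
        rw [uIcc_of_le hT]; exact (intervalIntegrable_iff_integrableOn_Icc_of_le hT).1 hh)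
    rwa [uIcc_of_le hT] at this

/-- The integrated semigroup `x ↦ ∫₀ᵗ S s x ds` as a bounded operator. -/
def integrated (hS : IsExtendedC0Semigroup S) (t : ℝ) : E →L[ℝ] E :=
  LinearMap.mkContinuousOfExistsBound
    { toFun := fun x => ∫ s in (0 : ℝ)..t, S s x
      map_add' := fun x y => by
        simp only [map_add]
        exact intervalIntegral.integral_add ((hS.continuous_apply x).intervalIntegrable _ _)
          ((hS.continuous_apply y).intervalIntegrable _ _)
      map_smul' := fun c x => by simp }
    (by
      obtain ⟨K, -, hK⟩ := hS.exists_bound (max 0 t)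
      refine ⟨K * |t - 0|, fun x => ?_⟩
      have := intervalIntegral.norm_integral_le_of_norm_le_const (a := 0) (b := t)
        (f := fun s => S s x) (C := K * ‖x‖) fun s hs =>
          (S s).le_of_opNorm_le (hK s hs.2) x
      calc _ ≤ _ := this
        _ = _ := by ring)

theorem integrated_apply (hS : IsExtendedC0Semigroup S) (t : ℝ) (x : E) :
    hS.integrated t x = ∫ s in (0 : ℝ)..t, S s x := rfl

/-- Both sides are `∫ₜ^(t+η) S s x ds - ∫₀^η S s x ds`. -/
theorem apply_integrated_sub (hS : IsExtendedC0Semigroup S) {η t : ℝ} (hη : 0 ≤ η) (ht : 0 ≤ t)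
    (x : E) :
    S η (hS.integrated t x) - hS.integrated t x = hS.integrated η (S t x - x) := by
  have hi : ∀ a b, IntervalIntegrable (fun s => S s x) MeasureTheory.volume a b := fun a b =>
    (hS.continuous_apply x).intervalIntegrable a b
  have key : ∀ a b : ℝ, 0 ≤ a → 0 ≤ b → S a (hS.integrated b x) = ∫ s in a..(a + b), S s x := by
    intro a b ha hb
    rw [integrated_apply, ← ContinuousLinearMap.intervalIntegral_comp_comm _ (hi _ _)]
    have h1 : ∫ s in (0 : ℝ)..b, S a (S s x) = ∫ s in (0 : ℝ)..b, S (a + s) x := by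
      refine intervalIntegral.integral_congr fun s hs => ?_
      rw [uIcc_of_le hb] at hs
      exact (hS.map_add_apply ha hs.1 x).symm
    rw [h1, intervalIntegral.integral_comp_add_left (fun s => S s x), add_zero]
  have key' : hS.integrated η (S t x) = ∫ s in t..(t + η), S s x := by
    rw [← key t η ht hη, integrated_apply, integrated_apply,
      ← ContinuousLinearMap.intervalIntegral_comp_comm _ (hi _ _)]
    refine intervalIntegral.integral_congr fun s hs => ?_
    rw [uIcc_of_le hη] at hs
    simp only [← hS.map_add_apply ht hs.1, ← hS.map_add_apply hs.1 ht, add_comm]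
  rw [map_sub, key η t hη ht, key', integrated_apply, integrated_apply]
  have e1 := intervalIntegral.integral_add_adjacent_intervals (hi 0 η) (hi η (η + t))
  have e2 := intervalIntegral.integral_add_adjacent_intervals (hi 0 t) (hi t (t + η))
  rw [sub_eq_sub_iff_add_eq_add, add_comm _ (∫ s in (0 : ℝ)..η, S s x), e1,
    add_comm _ (∫ s in (0 : ℝ)..t, S s x), e2, add_comm]

theorem tendsto_integrated (hS : IsExtendedC0Semigroup S) (y : E) :
    Tendsto (fun η : ℝ => η⁻¹ • hS.integrated η y) (𝓝[>] 0) (𝓝 y) := by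
  have h := ((hS.continuous_apply y).integral_hasStrictDerivAt 0 0).hasDerivAt
  have h' := h.tendsto_slope_zero_right
  simpa [hS.map_zero_apply, integrated_apply] using h'

/-- A vector `Z` with `S η Z - Z = ∫₀^η S σ y dσ` for all `η > 0` lies in the domain of the
generator, which maps it to `y`. -/
theorem mem_graph_of_integrated (hS : IsExtendedC0Semigroup S) {B : E →ₗ.[ℝ] E}
    (hB : IsGeneratorOf B S) {Z y : E} (h : ∀ η > 0, S η Z - Z = hS.integrated η y) :
    (Z, y) ∈ B.graph := by
  rw [hB]
  refine (hS.tendsto_integrated y).congr' ?_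
  filter_upwards [self_mem_nhdsWithin] with η hη
  rw [h η hη]

/-- Fubini's theorem for the convolution. -/
theorem integral_duhamel (hS : IsExtendedC0Semigroup S) {h : ℝ → E} {T : ℝ} (hT : 0 ≤ T)
    (hh : IntervalIntegrable h MeasureTheory.volume 0 T) :
    IntervalIntegrable (fun r => hS.integrated (T - r) (h r)) MeasureTheory.volume 0 T ∧
    ∫ t in (0 : ℝ)..T, duhamel S h t = ∫ r in (0 : ℝ)..T, hS.integrated (T - r) (h r) := by
  obtain ⟨K, -, hK⟩ := hS.exists_bound T
  set μ := MeasureTheory.volume.restrict (Ioc 0 T) with hμ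
  have hh' : MeasureTheory.Integrable h μ := (intervalIntegrable_iff_integrableOn_Ioc_of_le hT).1 hh
  let g : ℝ × ℝ → E := indicator {p : ℝ × ℝ | p.2 ≤ p.1} fun p => S (p.1 - p.2) (h p.2)
  have hset : MeasurableSet {p : ℝ × ℝ | p.2 ≤ p.1} :=
    measurableSet_le measurable_snd measurable_fst
  have hfin : MeasureTheory.IsFiniteMeasure μ := by rw [hμ]; infer_instance
  have hg : MeasureTheory.Integrable g (μ.prod μ) := by
    refine MeasureTheory.Integrable.mono' (g := fun p : ℝ × ℝ => K * ‖h p.2‖)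
      ((hh'.norm.comp_snd μ).const_mul K) ?_ ?_
    · refine MeasureTheory.AEStronglyMeasurable.indicator ?_ hset
      exact hS.continuous_uncurry.comp_aestronglyMeasurable
        ((by fun_prop : Continuous fun p : ℝ × ℝ => p.1 - p.2).aestronglyMeasurable.prodMk
          hh'.aestronglyMeasurable.comp_snd)
    · have : ∀ᵐ p ∂(μ.prod μ), p ∈ Ioc 0 T ×ˢ Ioc 0 T := by
        rw [hμ, MeasureTheory.Measure.prod_restrict]
        exact MeasureTheory.ae_restrict_mem (measurableSet_Ioc.prod measurableSet_Ioc)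
      filter_upwards [this] with p hp
      refine (norm_indicator_le_norm_self _ _).trans ?_
      exact (S (p.1 - p.2)).le_of_opNorm_le (hK _ (by linarith [hp.1.2, hp.2.1])) _
  have hleft : ∀ t ∈ Ioc 0 T, ∫ r, g (t, r) ∂μ = duhamel S h t := by
    intro t ht
    have e : (fun r => g (t, r)) = indicator (Iic t) fun r => S (t - r) (h r) := by
      funext r; simp [g, indicator]
    rw [e, MeasureTheory.integral_indicator measurableSet_Iic, hμ,
      MeasureTheory.Measure.restrict_restrict measurableSet_Iic, duhamel,
      intervalIntegral.integral_of_le ht.1.le]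
    congr 2
    ext r; simp only [mem_inter_iff, mem_Iic, mem_Ioc]
    constructor
    · rintro ⟨h1, h2, h3⟩; exact ⟨h2, h1⟩
    · rintro ⟨h1, h2⟩; exact ⟨h2, h1, h2.trans ht.2⟩
  have hright : ∀ r ∈ Ioc 0 T, ∫ t, g (t, r) ∂μ = hS.integrated (T - r) (h r) := by
    intro r hr
    have e : (fun t => g (t, r)) = indicator (Ici r) fun t => S (t - r) (h r) := by
      funext t; simp [g, indicator]
    rw [e, MeasureTheory.integral_indicator measurableSet_Ici, hμ,
      MeasureTheory.Measure.restrict_restrict measurableSet_Ici]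
    have : Ici r ∩ Ioc 0 T = Icc r T := by
      ext t; simp only [mem_inter_iff, mem_Ici, mem_Ioc, mem_Icc]
      constructor
      · rintro ⟨h1, h2, h3⟩; exact ⟨h1, h3⟩
      · rintro ⟨h1, h2⟩; exact ⟨h1, hr.1.trans_le h1, h2⟩
    rw [this, MeasureTheory.integral_Icc_eq_integral_Ioc, ← intervalIntegral.integral_of_le hr.2,
      intervalIntegral.integral_comp_sub_right (fun s => S s (h r)), sub_self, integrated_apply]
  refine ⟨?_, ?_⟩
  · rw [intervalIntegrable_iff_integrableOn_Ioc_of_le hT]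
    refine (MeasureTheory.Integrable.integral_prod_right hg).congr ?_
    filter_upwards [MeasureTheory.ae_restrict_mem measurableSet_Ioc] with r hr using hright r hr
  · rw [intervalIntegral.integral_of_le hT, intervalIntegral.integral_of_le hT,
      ← MeasureTheory.setIntegral_congr_fun measurableSet_Ioc hleft,
      ← MeasureTheory.setIntegral_congr_fun measurableSet_Ioc hright]
    exact MeasureTheory.integral_integral_swap (f := fun t r => g (t, r)) hg

/-- The variation of constants formula gives a solution of the time-integrated equation. -/
theorem integral_mild_mem_graph (hS : IsExtendedC0Semigroup S) {B : E →ₗ.[ℝ] E}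
    (hB : IsGeneratorOf B S) {h : ℝ → E} {T : ℝ} (hT : 0 ≤ T)
    (hh : IntervalIntegrable h MeasureTheory.volume 0 T) (x : E) :
    (∫ t in (0 : ℝ)..T, (S t x + duhamel S h t),
      S T x + duhamel S h T - x - ∫ t in (0 : ℝ)..T, h t) ∈ B.graph := by
  have hd : IntervalIntegrable (duhamel S h) MeasureTheory.volume 0 T := by
    refine ContinuousOn.intervalIntegrable ?_
    rw [uIcc_of_le hT]; exact hS.continuousOn_duhamel hT hh
  obtain ⟨hW, hint⟩ := hS.integral_duhamel hT hh
  rw [intervalIntegral.integral_add ((hS.continuous_apply x).intervalIntegrable _ _) hd, hint,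
    ← integrated_apply hS]
  refine hS.mem_graph_of_integrated hB fun η hη => ?_
  have e : S η (∫ r in (0 : ℝ)..T, hS.integrated (T - r) (h r))
      - (∫ r in (0 : ℝ)..T, hS.integrated (T - r) (h r))
      = hS.integrated η (duhamel S h T - ∫ t in (0 : ℝ)..T, h t) := by
    have hSh := hS.intervalIntegrable_apply T hh
    rw [duhamel, ← intervalIntegral.integral_sub hSh hh,
      ← ContinuousLinearMap.intervalIntegral_comp_comm _ (hSh.sub hh),
      ← ContinuousLinearMap.intervalIntegral_comp_comm _ hW,
      ← intervalIntegral.integral_sub ?_ hW]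
    rotate_left
    · rw [intervalIntegrable_iff] at hW ⊢
      exact (S η).integrable_comp hW
    refine intervalIntegral.integral_congr fun r hr => ?_
    rw [uIcc_of_le hT] at hr
    exact hS.apply_integrated_sub hη.le (by linarith [hr.2]) (h r)
  have e' : S T x + duhamel S h T - x - ∫ t in (0 : ℝ)..T, h t
      = (S T x - x) + (duhamel S h T - ∫ t in (0 : ℝ)..T, h t) := by abel
  rw [e', map_add, map_add, ← e, ← hS.apply_integrated_sub hη.le hT]
  abel

/-- A continuous function whose primitive solves `Y' = B Y`, `Y(0) = 0`, vanishes: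
`s ↦ S (t - s) (Y s)` has right derivative zero on `[0, t]`. -/
theorem eq_zero_of_integral_mem_graph (hS : IsExtendedC0Semigroup S) {B : E →ₗ.[ℝ] E}
    (hB : IsGeneratorOf B S) {y : ℝ → E} {T : ℝ} (hy : ContinuousOn y (Icc 0 T))
    (h : ∀ t ∈ Icc 0 T, (∫ s in (0 : ℝ)..t, y s, y t) ∈ B.graph) : ∀ t ∈ Icc 0 T, y t = 0 := by
  intro t ht
  have hT : 0 ≤ T := ht.1.trans ht.2
  set Y : ℝ → E := fun r => ∫ s in (0 : ℝ)..r, y s with hY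
  have hYc : ContinuousOn Y (Icc 0 T) := by
    have := intervalIntegral.continuousOn_primitive_interval (μ := MeasureTheory.volume)
      (f := y) (a := 0) (b := T) (by rw [uIcc_of_le hT]; exact hy.integrableOn_Icc)
    rwa [uIcc_of_le hT] at this
  have hYd : ∀ r ∈ Ico 0 T, HasDerivWithinAt Y (y r) (Ici r) r := by
    intro r hr
    have hyr : IntervalIntegrable y MeasureTheory.volume 0 r := by
      refine ContinuousOn.intervalIntegrable ?_
      rw [uIcc_of_le hr.1]; exact hy.mono (Icc_subset_Icc_right hr.2.le)
    have hsub : Ioc r T ∈ 𝓝[>] r := Ioc_mem_nhdsGT hr.2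
    refine intervalIntegral.integral_hasDerivWithinAt_right hyr (t := Ioi r)
      ⟨Ioc r T, hsub, ?_⟩ ?_
    · exact (hy.mono (fun s hs => ⟨hr.1.trans hs.1.le, hs.2⟩)).aestronglyMeasurable
        measurableSet_Ioc
    · exact (hy r ⟨hr.1, hr.2.le⟩).mono_of_mem_nhdsWithin
        (mem_of_superset hsub fun s hs => ⟨hr.1.trans hs.1.le, hs.2⟩)
  have hYt : Y t = 0 := by
    have hc : ContinuousOn (fun s => S (t - s) (Y s)) (Icc 0 t) :=
      hS.continuous_uncurry.comp_continuousOn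
        ((by fun_prop : ContinuousOn (fun s : ℝ => t - s) (Icc 0 t)).prodMk
          (hYc.mono (Icc_subset_Icc_right ht.2)))
    have hd : ∀ s ∈ Ico 0 t, HasDerivWithinAt (fun s => S (t - s) (Y s)) 0 (Ici s) s := by
      intro s hs
      have hsT : s ∈ Ico 0 T := ⟨hs.1, hs.2.trans_le ht.2⟩
      have h1 : Tendsto (fun η : ℝ => η⁻¹ • (Y (s + η) - Y s)) (𝓝[>] 0) (𝓝 (y s)) := by
        exact hasDerivWithinAt_Ici_iff_tendsto.1 (hYd s hsT)
      have h2 : Tendsto (fun η : ℝ => η⁻¹ • (S η (Y s) - Y s)) (𝓝[>] 0) (𝓝 (y s)) :=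
        (hB _ _).1 (h s ⟨hsT.1, hsT.2.le⟩)
      have h3 := h1.sub h2
      rw [sub_self] at h3
      have h4 : Tendsto (fun η : ℝ => t - (s + η)) (𝓝[>] 0) (𝓝 (t - s)) := by
        have : Continuous fun η : ℝ => t - (s + η) := by fun_prop
        simpa using (this.tendsto 0).mono_left nhdsWithin_le_nhds
      have h5 := (hS.continuous_uncurry.tendsto (t - s, 0)).comp (h4.prodMk_nhds h3)
      rw [map_zero] at h5
      refine hasDerivWithinAt_Ici_iff_tendsto.2 (h5.congr' ?_)
      filter_upwards [Ioc_mem_nhdsGT (sub_pos.2 hs.2)] with η hη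
      have e : S (t - s) (Y s) = S (t - (s + η)) (S η (Y s)) := by
        rw [← hS.map_add_apply (by linarith [hη.2]) hη.1.le]
        congr 2; ring
      rw [e, ← map_sub, ← map_smul]
      simp only [Function.comp_apply, ← smul_sub]
      congr 2; abel
    have := constant_of_has_deriv_right_zero hc hd t ⟨ht.1, le_rfl⟩
    simpa [hS.map_zero_apply, hY] using this
  have hg := h t ht
  change (Y t, y t) ∈ B.graph at hg
  rw [hYt] at hg
  exact B.graph_fst_eq_zero_snd hg rfl

theorem duhamel_add (hS : IsExtendedC0Semigroup S) {h : ℝ → E} {t s : ℝ} (ht : 0 ≤ t) (hs : 0 ≤ s)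
    (hh : IntervalIntegrable h MeasureTheory.volume 0 (t + s)) :
    duhamel S h (t + s) = S s (duhamel S h t) + duhamel S (fun r => h (t + r)) s := by
  have h0 : IntervalIntegrable h MeasureTheory.volume 0 t :=
    hh.mono_set (by
      rw [uIcc_of_le ht, uIcc_of_le (by linarith)]; exact Icc_subset_Icc_right (by linarith))
  have h1 : IntervalIntegrable h MeasureTheory.volume t (t + s) :=
    hh.mono_set (by
      rw [uIcc_of_le (by linarith), uIcc_of_le (by linarith)]; exact Icc_subset_Icc_left ht)
  rw [duhamel, ← intervalIntegral.integral_add_adjacent_intervals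
    (hS.intervalIntegrable_apply (t + s) h0) (hS.intervalIntegrable_apply (t + s) h1)]
  congr 1
  · rw [duhamel, ← ContinuousLinearMap.intervalIntegral_comp_comm _
      (hS.intervalIntegrable_apply t h0)]
    refine intervalIntegral.integral_congr fun r hr => ?_
    rw [uIcc_of_le ht] at hr
    simp only [← hS.map_add_apply hs (sub_nonneg.2 hr.2)]
    congr 2; ring
  · have := intervalIntegral.integral_comp_add_left (a := 0) (b := s)
      (fun r => S (t + s - r) (h r)) t
    rw [add_zero] at this
    rw [← this, duhamel]
    refine intervalIntegral.integral_congr fun r _ => ?_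
    simp only [add_sub_add_left_eq_sub]

theorem apply_sub_eq_integral (hS : IsExtendedC0Semigroup S) {B : E →ₗ.[ℝ] E}
    (hB : IsGeneratorOf B S) {x y : E} (hx : (x, y) ∈ B.graph) {t : ℝ} (ht : 0 ≤ t) :
    S t x - x = ∫ s in (0 : ℝ)..t, S s y := by
  rw [intervalIntegral.integral_eq_sub_of_hasDeriv_right (f := fun s => S s x)
    (hS.continuous_apply x).continuousOn _ ((hS.continuous_apply y).intervalIntegrable _ _),
    hS.map_zero_apply]
  intro s hs
  rw [min_eq_left ht] at hs
  refine (hasDerivWithinAt_Ici_iff_tendsto.2 ?_).Ioi_of_Ici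
  refine (((S s).continuous.tendsto y).comp ((hB x y).1 hx)).congr' ?_
  filter_upwards [self_mem_nhdsWithin] with η hη
  rw [hS.map_add_apply hs.1.le (le_of_lt hη), ← map_sub, ← map_smul]
  rfl

end IsExtendedC0Semigroup
end SemigroupTheory

/-! ### The smoothing property of analytic semigroups -/

section AnalyticSemigroups

variable {E : Type*} [NormedAddCommGroup E] [NormedSpace ℝ E]

theorem IsAnalyticSemigroup.extend {S : ℝ → E →L[ℝ] E} (hS : IsAnalyticSemigroup S) :
    IsAnalyticSemigroup (fun t => S (max t 0)) := by
  obtain ⟨θ, h0, h1, R, hR, hRS, hR'⟩ := hS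
  refine ⟨θ, h0, h1, R, hR, fun t ht x => ?_, hR'⟩
  simp only [max_eq_left ht.le, hRS t ht x]

/-- The complex linear extension `(x, y) ↦ ℓ x + i ℓ y` of a real functional to the
complexification. -/
def complexifyDual (l : StrongDual ℝ E) (p : E × E) : ℂ := l p.1 + Complex.I * l p.2

theorem complexifyDual_sub (l : StrongDual ℝ E) (p q : E × E) :
    complexifyDual l (p - q) = complexifyDual l p - complexifyDual l q := by
  simp [complexifyDual]; ring

theorem complexifyDual_smul (l : StrongDual ℝ E) (c : ℂ) (p : E × E) :
    complexifyDual l (complexSMul c p) = c * complexifyDual l p := by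
  apply Complex.ext <;> simp [complexifyDual, complexSMul, add_comm]

theorem continuous_complexifyDual (l : StrongDual ℝ E) : Continuous (complexifyDual l) := by
  unfold complexifyDual
  fun_prop

theorem norm_complexifyDual_le (l : StrongDual ℝ E) (p : E × E) :
    ‖complexifyDual l p‖ ≤ 2 * ‖l‖ * ‖p‖ := by
  have h1 : ‖l p.1‖ ≤ ‖l‖ * ‖p‖ := l.le_opNorm_of_le (norm_fst_le p)
  have h2 : ‖l p.2‖ ≤ ‖l‖ * ‖p‖ := l.le_opNorm_of_le (norm_snd_le p)
  refine (norm_add_le _ _).trans ?_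
  rw [norm_mul, Complex.norm_I, one_mul, Complex.norm_real, Complex.norm_real]
  linarith

/-- A ball around `1` lies in the sector; by scaling so does `ball t (c t)` for every `t > 0`. -/
theorem exists_ball_subset_openSector {θ : ℝ} (hθ : 0 < θ) :
    ∃ c : ℝ, 0 < c ∧ c ≤ 1 ∧ ∀ t : ℝ, 0 < t → Metric.ball (t : ℂ) (c * t) ⊆ openSector θ := by
  have h1 : ∀ᶠ z : ℂ in 𝓝 1, z ≠ 0 ∧ |z.arg| < θ := by
    refine (isOpen_ne.eventually_mem one_ne_zero).and ?_
    have : Tendsto (fun z : ℂ => |z.arg|) (𝓝 1) (𝓝 |(1 : ℂ).arg|) :=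
      (Complex.continuousAt_arg (by simp)).abs
    rw [Complex.arg_one, abs_zero] at this
    exact this.eventually (gt_mem_nhds hθ)
  obtain ⟨c, hc, hball⟩ := Metric.eventually_nhds_iff_ball.1 h1
  refine ⟨min c 1, lt_min hc one_pos, min_le_right _ _, fun t ht z hz => ?_⟩
  have ht' : (t : ℂ) ≠ 0 := by exact_mod_cast ht.ne'
  have hzt : z = (t : ℂ) * (z / t) := by field_simp
  have hmem : z / t ∈ Metric.ball (1 : ℂ) c := by
    rw [mem_ball_iff_norm] at hz ⊢
    have e : z / t - 1 = (z - t) / t := by field_simp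
    rw [e, norm_div, Complex.norm_real, Real.norm_of_nonneg ht.le, div_lt_iff₀ ht]
    exact hz.trans_le (by gcongr; exact min_le_left _ _)
  obtain ⟨h0, h2⟩ := hball _ hmem
  refine ⟨?_, ?_⟩
  · rw [hzt]; exact mul_ne_zero ht' h0
  · rw [hzt, Complex.arg_real_mul _ ht]; exact h2

/-- Strong convergence as `z → 0` in `s` implies a uniform bound near `0`, by Banach–Steinhaus. -/
theorem exists_bound_near_zero_of_tendsto [CompleteSpace E] {R : ℂ → E →L[ℝ] E} {s : Set ℂ}
    (hR : ∀ p, Tendsto (fun z => R z p) (𝓝[s] 0) (𝓝 p)) :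
    ∃ ρ K : ℝ, 0 < ρ ∧ ∀ z ∈ s, ‖z‖ < ρ → ‖R z‖ ≤ K := by
  by_contra! hcon
  choose z hzs hz hzn using fun n : ℕ => hcon (1 / (n + 1)) n (by positivity)
  have hz0 : Tendsto z atTop (𝓝[s] 0) :=
    tendsto_nhdsWithin_iff.2 ⟨squeeze_zero_norm (fun n => (hz n).le)
      tendsto_one_div_add_atTop_nhds_zero_nat, Eventually.of_forall hzs⟩
  obtain ⟨K, hK⟩ := banach_steinhaus (g := fun n => R (z n)) fun p => by
    obtain ⟨C, hC⟩ := ((hR p).comp hz0).norm.bddAbove_range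
    exact ⟨C, fun n => hC ⟨n, rfl⟩⟩
  obtain ⟨n, hn⟩ := exists_nat_gt K
  exact absurd (hzn n) (not_lt.2 ((hK n).trans hn.le))

variable [CompleteSpace E] {S : ℝ → E →L[ℝ] E}

/-- The smoothing property of an analytic semigroup for small times: apply the Schwarz lemma to the
scalar holomorphic functions `z ↦ ℓ (R z x)` on the discs `ball t (c t)` inside the sector. -/
theorem IsAnalyticSemigroup.exists_norm_sub_le_of_small (hS : IsExtendedC0Semigroup S)
    (hA : IsAnalyticSemigroup S) (T : ℝ) :
    ∃ ρ L : ℝ, 0 < ρ ∧ 0 ≤ L ∧ ∀ t r, 0 < t → t < ρ → 0 ≤ r → t + r ≤ T →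
      ‖S (t + r) - S t‖ ≤ L * r / t := by
  obtain ⟨θ, hθ, -, R, -, hRS, -, hRd, hR0⟩ := hA
  obtain ⟨c, hc, hc1, hball⟩ := exists_ball_subset_openSector hθ
  obtain ⟨ρ, K', hρ, hK'⟩ := exists_bound_near_zero_of_tendsto hR0
  obtain ⟨K₀, hK₀1, hK₀⟩ := hS.exists_bound T
  set K := max K' 0
  have hK : ∀ z ∈ openSector θ, ‖z‖ < ρ → ‖R z‖ ≤ K := fun z h1 h2 =>
    (hK' z h1 h2).trans (le_max_left _ _)
  have hKn : 0 ≤ K := le_max_right _ _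
  refine ⟨ρ / 2, (4 * K + 2 * K₀) / c, by positivity, by positivity, fun t r ht htρ hr hT => ?_⟩
  rcases lt_or_ge r (c * t) with hrc | hrc
  · refine ContinuousLinearMap.opNorm_le_bound _ (by positivity) fun x => ?_
    refine NormedSpace.norm_le_dual_bound ℝ _ (by positivity) fun l => ?_
    have hsec : ∀ z ∈ Metric.ball (t : ℂ) (c * t), z ∈ openSector θ ∧ ‖z‖ < ρ := by
      intro z hz
      refine ⟨hball t ht hz, ?_⟩
      rw [mem_ball_iff_norm] at hz
      have h1 := norm_sub_norm_le z (t : ℂ)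
      rw [Complex.norm_real, Real.norm_of_nonneg ht.le] at h1
      nlinarith
    let g : ℂ → ℂ := fun z => complexifyDual l (R z (x, 0))
    have hgr : ∀ s : ℝ, 0 < s → g s = (l (S s x) : ℝ) := by
      intro s hs
      simp [g, hRS s hs, complexifyDual]
    have hg : DifferentiableOn ℂ g (Metric.ball (t : ℂ) (c * t)) := by
      intro z hz
      obtain ⟨p', hp'⟩ := hRd z (hsec z hz).1 (x, 0)
      have hd : HasDerivAt g (complexifyDual l p') z := by
        rw [hasDerivAt_iff_tendsto_slope_zero]
        refine (((continuous_complexifyDual l).tendsto p').comp hp').congr fun h => ?_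
        simp only [Function.comp_apply, complexifyDual_smul, complexifyDual_sub, smul_eq_mul, g]
      exact hd.differentiableAt.differentiableWithinAt
    have hgb : ∀ z ∈ Metric.ball (t : ℂ) (c * t), ‖g z‖ ≤ 2 * ‖l‖ * (K * ‖x‖) := by
      intro z hz
      refine (norm_complexifyDual_le l _).trans ?_
      gcongr
      have h1 := (R z).le_of_opNorm_le (hK z (hsec z hz).1 (hsec z hz).2) (x, 0)
      simpa using h1
    have htm : (t : ℂ) ∈ Metric.ball (t : ℂ) (c * t) := Metric.mem_ball_self (by positivity)
    have hmaps : MapsTo g (Metric.ball (t : ℂ) (c * t))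
        (Metric.closedBall (g t) (4 * ‖l‖ * (K * ‖x‖))) := by
      intro z hz
      rw [mem_closedBall_iff_norm]
      refine (norm_sub_le _ _).trans ?_
      linarith [hgb z hz, hgb t htm]
    have hzr : ((t + r : ℝ) : ℂ) ∈ Metric.ball (t : ℂ) (c * t) := by
      rw [mem_ball_iff_norm, ← Complex.ofReal_sub, Complex.norm_real, add_sub_cancel_left,
        Real.norm_of_nonneg hr]
      exact hrc
    have key := Complex.dist_le_div_mul_dist_of_mapsTo_ball hg hmaps hzr
    rw [hgr _ ht, hgr _ (by positivity), dist_eq_norm, dist_eq_norm, ← Complex.ofReal_sub,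
      ← Complex.ofReal_sub, Complex.norm_real, Complex.norm_real, add_sub_cancel_left,
      Real.norm_of_nonneg hr, ← map_sub] at key
    refine key.trans ?_
    have e : 4 * ‖l‖ * (K * ‖x‖) / (c * t) * r = 4 * K / c * r / t * ‖x‖ * ‖l‖ := by
      field_simp
    rw [e]
    gcongr
    linarith
  -- outside the disc `r / t` is bounded below
  · have h1 : ‖S (t + r) - S t‖ ≤ 2 * K₀ := by
      refine (norm_sub_le _ _).trans ?_
      linarith [hK₀ (t + r) hT, hK₀ t (by linarith)]
    refine h1.trans ?_
    rw [div_mul_eq_mul_div, div_div, le_div_iff₀ (by positivity)]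
    nlinarith

theorem IsAnalyticSemigroup.exists_norm_add_sub_le (hS : IsExtendedC0Semigroup S)
    (hA : IsAnalyticSemigroup S) (T : ℝ) :
    ∃ L : ℝ, 0 ≤ L ∧ ∀ t r, 0 < t → 0 ≤ r → t + r ≤ T → ‖S (t + r) - S t‖ ≤ L * r / t := by
  obtain ⟨ρ, L, hρ, hL, h⟩ := hA.exists_norm_sub_le_of_small hS T
  obtain ⟨K, hK1, hK⟩ := hS.exists_bound T
  refine ⟨max L (K * L / (ρ / 2) * |T|), le_max_of_le_left hL, fun t r ht hr hT => ?_⟩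
  rcases lt_or_ge t ρ with htρ | htρ
  · refine (h t r ht htρ hr hT).trans ?_
    gcongr
    exact le_max_left _ _
  -- for large `t` the semigroup law moves the increment to the fixed time `ρ / 2`
  · have e : S (t + r) - S t = (S (t - ρ / 2)).comp (S (ρ / 2 + r) - S (ρ / 2)) := by
      have h1 := hS.map_add (t - ρ / 2) (ρ / 2 + r) (by linarith) (by positivity)
      have h2 := hS.map_add (t - ρ / 2) (ρ / 2) (by linarith) (by positivity)
      rw [show t - ρ / 2 + (ρ / 2 + r) = t + r by ring] at h1
      rw [sub_add_cancel] at h2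
      rw [h1, h2, ContinuousLinearMap.comp_sub]
    have hsmall := h (ρ / 2) r (by positivity) (by linarith) hr (by linarith)
    calc ‖S (t + r) - S t‖ ≤ ‖S (t - ρ / 2)‖ * ‖S (ρ / 2 + r) - S (ρ / 2)‖ := by
          rw [e]; exact ContinuousLinearMap.opNorm_comp_le _ _
      _ ≤ K * (L * r / (ρ / 2)) := by
          gcongr
          exact hK _ (by linarith)
      _ ≤ K * (L * r / (ρ / 2)) * (|T| / t) := by
          refine le_mul_of_one_le_right (by positivity) ?_
          rw [one_le_div ht]
          exact (by linarith : t ≤ T).trans (le_abs_self T)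
      _ = (K * L / (ρ / 2) * |T|) * r / t := by ring
      _ ≤ _ := by
          gcongr
          exact le_max_right _ _

/-- The smoothing property of an analytic semigroup: on `[t, T]` it is Lipschitz continuous in
operator norm, with constant `L / t`. -/
theorem IsAnalyticSemigroup.exists_norm_sub_le (hS : IsExtendedC0Semigroup S)
    (hA : IsAnalyticSemigroup S) (T : ℝ) :
    ∃ L : ℝ, 0 ≤ L ∧ ∀ t a b, 0 < t → t ≤ a → a ≤ T → t ≤ b → b ≤ T →
      ‖S a - S b‖ ≤ L * |a - b| / t := by
  obtain ⟨L, hL, h⟩ := hA.exists_norm_add_sub_le hS T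
  have main : ∀ t a b, 0 < t → t ≤ b → b ≤ a → a ≤ T → ‖S a - S b‖ ≤ L * |a - b| / t := by
    intro t a b ht htb hba ha
    have h1 := h b (a - b) (ht.trans_le htb) (sub_nonneg.2 hba) (by linarith)
    rw [add_sub_cancel] at h1
    rw [abs_of_nonneg (sub_nonneg.2 hba)]
    refine h1.trans ?_
    have := sub_nonneg.2 hba
    gcongr
  refine ⟨L, hL, fun t a b ht h1 h2 h3 h4 => ?_⟩
  rcases le_total b a with hab | hab
  · exact main t a b ht h3 hab h2
  · rw [norm_sub_rev, abs_sub_comm]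
    exact main t b a ht h1 hab h4

end AnalyticSemigroups

/-! ### The midpoint rule, ordinary differential equations and bounds near compact sets -/

section Calculus

variable {E : Type*} [NormedAddCommGroup E] [NormedSpace ℝ E]

/-- The midpoint rule for a function with Lipschitz continuous derivative. -/
theorem norm_integral_sub_midpoint_le [CompleteSpace E] {g g' : ℝ → E} {τ L : ℝ} (hτ : 0 ≤ τ)
    (hg : ∀ s ∈ Icc 0 τ, HasDerivWithinAt g (g' s) (Icc 0 τ) s)
    (hg' : ∀ s ∈ Icc 0 τ, ∀ r ∈ Icc 0 τ, ‖g' s - g' r‖ ≤ L * |s - r|) :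
    ‖(∫ s in (0 : ℝ)..τ, g s) - τ • g (τ / 2)‖ ≤ |L| * τ ^ 3 := by
  have hm : τ / 2 ∈ Icc 0 τ := ⟨by linarith, by linarith⟩
  -- subtracting the tangent at the midpoint changes neither side of the rule
  set k : ℝ → E := fun s => g s - (s - τ / 2) • g' (τ / 2) with hk
  have hkd : ∀ s ∈ Icc 0 τ, HasDerivWithinAt k (g' s - g' (τ / 2)) (Icc 0 τ) s := by
    intro s hs
    have h1 : HasDerivWithinAt (fun s : ℝ => (s - τ / 2) • g' (τ / 2)) ((1 : ℝ) • g' (τ / 2))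
        (Icc 0 τ) s := ((hasDerivWithinAt_id s _).sub_const _).smul_const _
    rw [one_smul] at h1
    exact (hg s hs).sub h1
  have hgc : ContinuousOn g (Icc 0 τ) := fun s hs => (hg s hs).continuousWithinAt
  have hkc : ContinuousOn k (Icc 0 τ) := fun s hs => (hkd s hs).continuousWithinAt
  have hkb : ∀ s ∈ Icc 0 τ, ‖k s - k (τ / 2)‖ ≤ |L| * τ ^ 2 := by
    intro s hs
    have h1 := Convex.norm_image_sub_le_of_norm_hasDerivWithin_le (C := |L| * τ) hkd (fun r hr => by
      refine (hg' r hr _ hm).trans ?_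
      have : |r - τ / 2| ≤ τ := abs_le.2 ⟨by linarith [hr.1], by linarith [hr.2]⟩
      exact mul_le_mul (le_abs_self L) this (abs_nonneg _) (abs_nonneg _)) (convex_Icc 0 τ) hm hs
    refine h1.trans ?_
    have : ‖s - τ / 2‖ ≤ τ := abs_le.2 ⟨by linarith [hs.1], by linarith [hs.2]⟩
    calc |L| * τ * ‖s - τ / 2‖ ≤ |L| * τ * τ := by gcongr
      _ = |L| * τ ^ 2 := by ring
  have hgi : IntervalIntegrable g MeasureTheory.volume 0 τ :=
    ContinuousOn.intervalIntegrable (by rwa [uIcc_of_le hτ])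
  have hki : IntervalIntegrable k MeasureTheory.volume 0 τ :=
    ContinuousOn.intervalIntegrable (by rwa [uIcc_of_le hτ])
  have hlin : ∫ s in (0 : ℝ)..τ, (s - τ / 2) • g' (τ / 2) = 0 := by
    rw [intervalIntegral.integral_smul_const, intervalIntegral.integral_sub
      (by simp) (by simp), integral_id, intervalIntegral.integral_const]
    have : (τ ^ 2 - 0 ^ 2) / 2 - (τ - 0) • (τ / 2) = 0 := by simp; ring
    rw [this, zero_smul]
  have e : (∫ s in (0 : ℝ)..τ, g s) - τ • g (τ / 2)
      = ∫ s in (0 : ℝ)..τ, (k s - k (τ / 2)) := by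
    rw [intervalIntegral.integral_sub hki (by simp), intervalIntegral.integral_const, hk,
      intervalIntegral.integral_sub hgi (Continuous.intervalIntegrable (by fun_prop) _ _), hlin]
    simp
  rw [e]
  have := intervalIntegral.norm_integral_le_of_norm_le_const (a := 0) (b := τ)
    (f := fun s => k s - k (τ / 2)) (C := |L| * τ ^ 2) fun s hs => by
      rw [uIoc_of_le hτ] at hs
      exact hkb s ⟨hs.1.le, hs.2⟩
  refine this.trans (le_of_eq ?_)
  rw [sub_zero, abs_of_nonneg hτ]; ring

/-- A curve whose speed is at most `R` as long as it stays in a ball cannot leave the ball quickly.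
The rate `R + 1` makes the comparison of derivatives strict. -/
theorem norm_sub_le_of_hasDerivWithinAt_of_bound {w w' : ℝ → E} {τ R δ : ℝ} {y : E}
    (hR : 0 ≤ R) (hw : ∀ s ∈ Icc 0 τ, HasDerivWithinAt w (w' s) (Icc 0 τ) s)
    (hb : ∀ s ∈ Icc 0 τ, ‖w s - y‖ ≤ δ → ‖w' s‖ ≤ R) (h0 : ‖w 0 - y‖ + (R + 1) * τ ≤ δ) :
    ∀ s ∈ Icc 0 τ, ‖w s - w 0‖ ≤ (R + 1) * s ∧ ‖w s - y‖ ≤ δ := by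
  have hball : ∀ s ∈ Icc 0 τ, ‖w s - w 0‖ ≤ (R + 1) * s → ‖w s - y‖ ≤ δ := by
    intro s hs h
    have h1 : w s - y = (w s - w 0) + (w 0 - y) := by abel
    rw [h1]
    refine (norm_add_le _ _).trans ?_
    have : (R + 1) * s ≤ (R + 1) * τ := by gcongr; exact hs.2
    linarith
  have key : ∀ s ∈ Icc 0 τ, ‖w s - w 0‖ ≤ (R + 1) * s := by
    refine image_norm_le_of_norm_deriv_right_lt_deriv_boundary (f := fun s => w s - w 0)
      (f' := w') (B := fun s => (R + 1) * s) (B' := fun _ => R + 1) ?_ ?_ ?_ ?_ ?_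
    · exact ContinuousOn.sub (fun s hs => (hw s hs).continuousWithinAt) continuousOn_const
    · intro s hs
      refine HasDerivWithinAt.sub_const _ ?_
      exact (hw s ⟨hs.1, hs.2.le⟩).mono_of_mem_nhdsWithin
        (mem_of_superset (Icc_mem_nhdsGE hs.2) (Icc_subset_Icc_left hs.1))
    · simp
    · intro s
      simpa using (hasDerivAt_id s).const_mul (R + 1)
    · intro s hs h
      have hs' : s ∈ Icc 0 τ := ⟨hs.1, hs.2.le⟩
      linarith [hb s hs' (hball s hs' h.le)]
  exact fun s hs => ⟨key s hs, hball s hs (key s hs)⟩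

/-- Local existence for `w' = f(w) - q` on an interval of prescribed length, by Picard–Lindelöf. -/
theorem exists_hasDerivWithinAt_sub [CompleteSpace E] {f : E → E} {q : ℝ → E} {y w₀ : E}
    {τ δ R L : ℝ} (hτ : 0 ≤ τ) (hq : ContinuousOn q (Icc 0 τ)) (hL : 0 ≤ L)
    (hf : ∀ x z, ‖x - y‖ ≤ δ → ‖z - y‖ ≤ δ → ‖f x - f z‖ ≤ L * ‖x - z‖)
    (hb : ∀ s ∈ Icc 0 τ, ∀ x, ‖x - y‖ ≤ δ → ‖f x - q s‖ ≤ R) (hR : 0 ≤ R)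
    (h0 : ‖w₀ - y‖ + R * τ ≤ δ) :
    ∃ w : ℝ → E, w 0 = w₀ ∧ ∀ s ∈ Icc 0 τ, HasDerivWithinAt w (f (w s) - q s) (Icc 0 τ) s := by
  have hδ : 0 ≤ δ := le_trans (by positivity) h0
  have hpl : IsPicardLindelof (fun s x => f x - q s) (tmin := 0) (tmax := τ) ⟨0, le_rfl, hτ⟩ y
      ⟨δ, hδ⟩ ⟨‖w₀ - y‖, norm_nonneg _⟩ ⟨R, hR⟩ ⟨L, hL⟩ := by
    refine ⟨?_, ?_, ?_, ?_⟩
    · intro s _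
      refine LipschitzOnWith.of_dist_le_mul fun x hx z hz => ?_
      rw [dist_eq_norm, dist_eq_norm, sub_sub_sub_cancel_right]
      exact hf x z (mem_closedBall_iff_norm.1 hx) (mem_closedBall_iff_norm.1 hz)
    · intro x _
      exact continuousOn_const.sub hq
    · intro s hs x hx
      exact hb s hs x (mem_closedBall_iff_norm.1 hx)
    · change R * max (τ - 0) (0 - 0) ≤ δ - ‖w₀ - y‖
      rw [sub_zero, sub_zero, max_eq_left hτ]
      linarith
  exact hpl.exists_eq_forall_mem_Icc_hasDerivWithinAt (mem_closedBall_iff_norm.2 le_rfl)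

/-- A locally bounded function is bounded on a uniform neighbourhood of a compact set. -/
theorem IsCompact.exists_bound_of_locally_bounded {E : Type*} [NormedAddCommGroup E] {s : Set E}
    (hs : IsCompact s) {φ : E → ℝ}
    (h : ∀ x, ∃ K : ℝ, ∀ᶠ y in 𝓝 x, φ y ≤ K) :
    ∃ δ K : ℝ, 0 < δ ∧ ∀ x ∈ s, ∀ y, ‖y - x‖ ≤ δ → φ y ≤ K := by
  have h1 : ∃ K : ℝ, ∀ᶠ y in 𝓝ˢ s, φ y ≤ K := by
    refine hs.induction_on (p := fun s => ∃ K : ℝ, ∀ᶠ y in 𝓝ˢ s, φ y ≤ K) ⟨0, by simp⟩ ?_ ?_ ?_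
    · rintro s t hst ⟨K, hK⟩
      exact ⟨K, hK.filter_mono (nhdsSet_mono hst)⟩
    · rintro s t ⟨K, hK⟩ ⟨K', hK'⟩
      refine ⟨max K K', ?_⟩
      rw [nhdsSet_union, eventually_sup]
      exact ⟨hK.mono fun y hy => hy.trans (le_max_left _ _),
        hK'.mono fun y hy => hy.trans (le_max_right _ _)⟩
    · intro x _
      obtain ⟨K, hK⟩ := h x
      obtain ⟨t, ht, hto, hxt⟩ := eventually_nhds_iff.1 hK
      exact ⟨t, mem_nhdsWithin_of_mem_nhds (hto.mem_nhds hxt), K,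
        mem_of_superset (hto.mem_nhdsSet.2 subset_rfl) ht⟩
  obtain ⟨K, hK⟩ := h1
  obtain ⟨t, hto, hst, ht⟩ := mem_nhdsSet_iff_exists.1 hK
  obtain ⟨δ, hδ, hδt⟩ := hs.exists_cthickening_subset_open hto hst
  refine ⟨δ, K, hδ, fun x hx y hy => ht (hδt ?_)⟩
  exact Metric.mem_cthickening_of_dist_le y x δ s hx (by rwa [dist_eq_norm])

/-- Uniform bounds for `f`, its Lipschitz constant and that of its derivative near a compact set,
for a twice differentiable `f` with locally bounded second derivative. -/
theorem IsCompact.exists_uniform_bounds {s : Set E} (hs : IsCompact s) {f : E → E}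
    (hf : Differentiable ℝ f) (hf' : Differentiable ℝ (fderiv ℝ f))
    (hf'' : ∀ x, ∃ K : ℝ, ∀ᶠ y in 𝓝 x, ‖fderiv ℝ (fderiv ℝ f) y‖ ≤ K) :
    ∃ δ K : ℝ, 0 < δ ∧ 0 ≤ K ∧ ∀ y ∈ s, ∀ x, ‖x - y‖ ≤ δ → ‖f x‖ ≤ K ∧ ‖fderiv ℝ f x‖ ≤ K ∧
      ∀ z, ‖z - y‖ ≤ δ → ‖f x - f z‖ ≤ K * ‖x - z‖ ∧
        ‖fderiv ℝ f x - fderiv ℝ f z‖ ≤ K * ‖x - z‖ := by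
  obtain ⟨δ, K, hδ, hK⟩ := hs.exists_bound_of_locally_bounded
    (φ := fun y => ‖f y‖ + ‖fderiv ℝ f y‖ + ‖fderiv ℝ (fderiv ℝ f) y‖) fun x => by
      obtain ⟨K, hK⟩ := hf'' x
      refine ⟨‖f x‖ + 1 + (‖fderiv ℝ f x‖ + 1) + K, ?_⟩
      have h1 : ∀ᶠ y in 𝓝 x, ‖f y‖ ≤ ‖f x‖ + 1 :=
        (hf.continuous.norm.tendsto x).eventually (eventually_le_nhds (by linarith))
      have h2 : ∀ᶠ y in 𝓝 x, ‖fderiv ℝ f y‖ ≤ ‖fderiv ℝ f x‖ + 1 :=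
        (hf'.continuous.norm.tendsto x).eventually (eventually_le_nhds (by linarith))
      filter_upwards [hK, h1, h2] with y a b c
      linarith
  refine ⟨δ, max K 0, hδ, le_max_right _ _, fun y hy x hx => ?_⟩
  have hK' : ∀ x, ‖x - y‖ ≤ δ → ‖f x‖ ≤ max K 0 ∧ ‖fderiv ℝ f x‖ ≤ max K 0 ∧
      ‖fderiv ℝ (fderiv ℝ f) x‖ ≤ max K 0 := by
    intro x hx
    have h1 := (hK y hy x hx).trans (le_max_left K 0)
    have h2 := norm_nonneg (f x)
    have h3 := norm_nonneg (fderiv ℝ f x)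
    have h4 := norm_nonneg (fderiv ℝ (fderiv ℝ f) x)
    exact ⟨by linarith, by linarith, by linarith⟩
  refine ⟨(hK' x hx).1, (hK' x hx).2.1, fun z hz => ⟨?_, ?_⟩⟩
  · exact (convex_closedBall y δ).norm_image_sub_le_of_norm_fderiv_le (fun w _ => hf w)
      (fun w hw => (hK' w (mem_closedBall_iff_norm.1 hw)).2.1) (mem_closedBall_iff_norm.2 hz)
      (mem_closedBall_iff_norm.2 hx)
  · exact (convex_closedBall y δ).norm_image_sub_le_of_norm_fderiv_le (fun w _ => hf' w)
      (fun w hw => (hK' w (mem_closedBall_iff_norm.1 hw)).2.2) (mem_closedBall_iff_norm.2 hz)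
      (mem_closedBall_iff_norm.2 hx)

theorem ContDiffOn.exists_deriv_bounds {g : ℝ → E} {T : ℝ} (hT : 0 < T)
    (hg : ContDiffOn ℝ 2 g (Icc 0 T)) :
    ∃ (g' : ℝ → E) (K : ℝ), (∀ t ∈ Icc 0 T, HasDerivWithinAt g (g' t) (Icc 0 T) t) ∧
      (∀ t ∈ Icc 0 T, ‖g' t‖ ≤ K) ∧
      ∀ s ∈ Icc 0 T, ∀ t ∈ Icc 0 T, ‖g' s - g' t‖ ≤ K * |s - t| := by
  have hu := uniqueDiffOn_Icc hT
  have h1 : ContDiffOn ℝ 1 (derivWithin g (Icc 0 T)) (Icc 0 T) :=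
    hg.derivWithin hu (by norm_num)
  have h2 : ContinuousOn (derivWithin (derivWithin g (Icc 0 T)) (Icc 0 T)) (Icc 0 T) :=
    h1.continuousOn_derivWithin hu le_rfl
  obtain ⟨K₁, hK₁⟩ := isCompact_Icc.exists_bound_of_continuousOn h1.continuousOn
  obtain ⟨K₂, hK₂⟩ := isCompact_Icc.exists_bound_of_continuousOn h2
  refine ⟨derivWithin g (Icc 0 T), max K₁ K₂, fun t ht =>
    ((hg.differentiableOn (by norm_num)) t ht).hasDerivWithinAt,
    fun t ht => (hK₁ t ht).trans (le_max_left _ _), fun s hs t ht => ?_⟩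
  exact Convex.norm_image_sub_le_of_norm_hasDerivWithin_le
    (fun r hr => ((h1.differentiableOn (by norm_num)) r hr).hasDerivWithinAt)
    (fun r hr => (hK₂ r hr).trans (le_max_right _ _)) (convex_Icc 0 T) ht hs

end Calculus

/-! ### Quadrature errors under a semigroup -/

namespace IsExtendedC0Semigroup

variable {E : Type*} [NormedAddCommGroup E] [NormedSpace ℝ E] [CompleteSpace E]
  {S : ℝ → E →L[ℝ] E}

theorem norm_apply_sub_apply_le (hS : IsExtendedC0Semigroup S) {B : E →ₗ.[ℝ] E}
    (hB : IsGeneratorOf B S) {x y : E} (hx : (x, y) ∈ B.graph) {K M a b T : ℝ}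
    (hK : ∀ t ≤ T, ‖S t‖ ≤ K) (hy : ‖y‖ ≤ M) (ha : 0 ≤ a) (haT : a ≤ T) (hb : 0 ≤ b) (hbT : b ≤ T) :
    ‖S a x - S b x‖ ≤ K * M * |a - b| := by
  have hi : ∀ a b, IntervalIntegrable (fun s => S s y) MeasureTheory.volume a b := fun a b =>
    (hS.continuous_apply y).intervalIntegrable a b
  have e : S a x - S b x = ∫ s in b..a, S s y := by
    rw [← intervalIntegral.integral_interval_sub_left (hi 0 a) (hi 0 b),
      ← hS.apply_sub_eq_integral hB hx ha, ← hS.apply_sub_eq_integral hB hx hb]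
    abel
  rw [e]
  refine intervalIntegral.norm_integral_le_of_norm_le_const fun s hs => ?_
  have hsT : s ≤ T := hs.2.trans (max_le hbT haT)
  exact (S s).le_of_opNorm_le_of_le (hK s hsT) hy

/-- The quadrature error of one step is of second order, and of third order up to the singular
factor `1 / t` after smoothing by `S t`: replacing `φ` by its value at the midpoint costs
`O(τ) ‖S (t + τ - s) - S (t + τ / 2)‖`, and what remains is the midpoint rule for `S (t + τ - s) x`
with `x` in the domain of the generator. -/
theorem norm_quadrature_error_le (hS : IsExtendedC0Semigroup S) {B : E →ₗ.[ℝ] E}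
    (hB : IsGeneratorOf B S) {φ : ℝ → E} {K M L τ T : ℝ} (hτ : 0 ≤ τ) (hτT : τ ≤ T)
    (hK : ∀ t ≤ T, ‖S t‖ ≤ K) (hM : 0 ≤ M) (hL : 0 ≤ L)
    (hLS : ∀ t a b, 0 < t → t ≤ a → a ≤ T → t ≤ b → b ≤ T → ‖S a - S b‖ ≤ L * |a - b| / t)
    (hφ : ∀ s ∈ Icc 0 τ, ∃ y, (φ s, y) ∈ B.graph ∧ ‖y‖ ≤ M)
    (hφL : ∀ s ∈ Icc 0 τ, ∀ r ∈ Icc 0 τ, ‖φ s - φ r‖ ≤ M * |s - r|) :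
    ‖duhamel S φ τ - S (τ / 2) (∫ s in (0 : ℝ)..τ, φ s)‖ ≤ K * M * τ ^ 2 ∧
    ∀ t, 0 < t → t + τ ≤ T →
      ‖S t (duhamel S φ τ - S (τ / 2) (∫ s in (0 : ℝ)..τ, φ s))‖ ≤ 2 * L * M * τ ^ 3 / t := by
  have hK0 : 0 ≤ K := (norm_nonneg _).trans (hK 0 (by linarith))
  have hm : τ / 2 ∈ Icc 0 τ := ⟨by linarith, by linarith⟩
  have hφc : ContinuousOn φ (Icc 0 τ) :=
    (LipschitzOnWith.of_dist_le_mul (K := ⟨M, hM⟩) fun s hs r hr => by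
      rw [dist_eq_norm, dist_eq_norm]; exact hφL s hs r hr).continuousOn
  have hφi : IntervalIntegrable φ MeasureTheory.volume 0 τ :=
    ContinuousOn.intervalIntegrable (by rwa [uIcc_of_le hτ])
  have hSφ := hS.intervalIntegrable_apply τ hφi
  have hSm : IntervalIntegrable (fun s => S (τ / 2) (φ s)) MeasureTheory.volume 0 τ := by
    rw [intervalIntegrable_iff] at hφi ⊢
    exact (S (τ / 2)).integrable_comp hφi
  have e : duhamel S φ τ - S (τ / 2) (∫ s in (0 : ℝ)..τ, φ s)
      = ∫ s in (0 : ℝ)..τ, (S (τ - s) (φ s) - S (τ / 2) (φ s)) := by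
    rw [intervalIntegral.integral_sub hSφ hSm, ContinuousLinearMap.intervalIntegral_comp_comm _ hφi]
    rfl
  have habs : ∀ s ∈ Icc 0 τ, |s - τ / 2| ≤ τ := fun s hs =>
    abs_le.2 ⟨by linarith [hs.1], by linarith [hs.2]⟩
  rw [e]
  constructor
  · refine (intervalIntegral.norm_integral_le_of_norm_le_const (C := K * M * τ)
      fun s hs => ?_).trans (le_of_eq ?_)
    · rw [uIoc_of_le hτ] at hs
      have hs' : s ∈ Icc 0 τ := ⟨hs.1.le, hs.2⟩
      obtain ⟨y, hy, hyM⟩ := hφ s hs'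
      refine (hS.norm_apply_sub_apply_le hB hy hK hyM (by linarith [hs.2]) (by linarith [hs.1])
        hm.1 (hm.2.trans hτT)).trans ?_
      gcongr
      rw [show τ - s - τ / 2 = -(s - τ / 2) by ring, abs_neg]
      exact habs s hs'
    · rw [sub_zero, abs_of_nonneg hτ]; ring
  · intro t ht htT
    set c := φ (τ / 2) with hc
    obtain ⟨y, hy, hyM⟩ := hφ _ hm
    have hi1 : IntervalIntegrable (fun s => S (τ - s) (φ s) - S (τ / 2) (φ s))
      MeasureTheory.volume 0 τ := hSφ.sub hSm
    have hi2 : IntervalIntegrable (fun s => S (t + τ - s) c) MeasureTheory.volume 0 τ :=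
      hS.intervalIntegrable_apply _ (by simp)
    have hi3 : IntervalIntegrable (fun s => S (t + τ - s) (φ s - c) - S (t + τ / 2) (φ s - c))
        MeasureTheory.volume 0 τ := by
      refine (hS.intervalIntegrable_apply _ (hφi.sub (by simp))).sub ?_
      have h0 : IntervalIntegrable (fun s => φ s - c) MeasureTheory.volume 0 τ := hφi.sub (by simp)
      rw [intervalIntegrable_iff] at h0 ⊢
      exact (S (t + τ / 2)).integrable_comp h0
    have e2 : S t (∫ s in (0 : ℝ)..τ, (S (τ - s) (φ s) - S (τ / 2) (φ s)))
        = (∫ s in (0 : ℝ)..τ, (S (t + τ - s) (φ s - c) - S (t + τ / 2) (φ s - c)))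
          + ((∫ s in (0 : ℝ)..τ, S (t + τ - s) c) - τ • S (t + τ / 2) c) := by
      have e3 : τ • S (t + τ / 2) c = ∫ s in (0 : ℝ)..τ, S (t + τ / 2) c := by simp
      rw [e3, ← intervalIntegral.integral_sub hi2 (by simp), ← intervalIntegral.integral_add hi3
        (hi2.sub (by simp)), ← ContinuousLinearMap.intervalIntegral_comp_comm _ hi1]
      refine intervalIntegral.integral_congr fun s hs => ?_
      rw [uIcc_of_le hτ] at hs
      simp only [map_sub]
      rw [← hS.map_add_apply ht.le (sub_nonneg.2 hs.2), ← hS.map_add_apply ht.le hm.1,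
        add_sub_assoc]
      abel
    have b1 : ‖∫ s in (0 : ℝ)..τ, (S (t + τ - s) (φ s - c) - S (t + τ / 2) (φ s - c))‖
        ≤ L * M * τ ^ 3 / t := by
      refine (intervalIntegral.norm_integral_le_of_norm_le_const (C := (L * τ / t) * (M * τ))
        fun s hs => ?_).trans (le_of_eq ?_)
      · rw [uIoc_of_le hτ] at hs
        have hs' : s ∈ Icc 0 τ := ⟨hs.1.le, hs.2⟩
        have h1 : ‖S (t + τ - s) - S (t + τ / 2)‖ ≤ L * τ / t := by
          refine (hLS t _ _ ht (by linarith [hs.2]) (by linarith [hs.1]) (by linarith)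
            (by linarith)).trans ?_
          gcongr
          rw [show t + τ - s - (t + τ / 2) = -(s - τ / 2) by ring, abs_neg]
          exact habs s hs'
        rw [← sub_apply]
        refine ContinuousLinearMap.le_of_opNorm_le_of_le _ h1 ((hφL s hs' _ hm).trans ?_)
        gcongr
        exact habs s hs'
      · rw [sub_zero, abs_of_nonneg hτ]; ring
    have b2 : ‖(∫ s in (0 : ℝ)..τ, S (t + τ - s) c) - τ • S (t + τ / 2) c‖
        ≤ L * M * τ ^ 3 / t := by
      have hd : ∀ s ∈ Icc 0 τ, HasDerivWithinAt (fun s => S (t + τ - s) c) (-(S (t + τ - s) y))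
          (Icc 0 τ) s := by
        intro s hs
        have h1 : HasDerivAt (fun r => ∫ σ in (0 : ℝ)..r, S σ y) (S (t + τ - s) y) (t + τ - s) :=
          ((hS.continuous_apply y).integral_hasStrictDerivAt 0 _).hasDerivAt
        have h2 : HasDerivAt (fun s : ℝ => t + τ - s) (-1) s := by
          simpa using (hasDerivAt_id s).const_sub (t + τ)
        have h3 := (h1.scomp s h2).const_add c
        rw [neg_one_smul] at h3
        refine h3.hasDerivWithinAt.congr (fun r hr => ?_) ?_
        · rw [Function.comp_apply, ← hS.apply_sub_eq_integral hB hy (by linarith [hr.2])]; abel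
        · rw [Function.comp_apply, ← hS.apply_sub_eq_integral hB hy (by linarith [hs.2])]; abel
      have h4 := norm_integral_sub_midpoint_le (L := L * M / t) hτ hd fun s hs r hr => by
        have h5 := hLS t (t + τ - s) (t + τ - r) ht (by linarith [hs.2]) (by linarith [hs.1])
          (by linarith [hr.2]) (by linarith [hr.1])
        rw [neg_sub_neg, norm_sub_rev, ← sub_apply]
        refine (ContinuousLinearMap.le_of_opNorm_le_of_le _ h5 hyM).trans (le_of_eq ?_)
        rw [show t + τ - s - (t + τ - r) = -(s - r) by ring, abs_neg]
        ring
      rw [show t + τ - τ / 2 = t + τ / 2 by ring, abs_of_nonneg (by positivity)] at h4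
      exact h4.trans (le_of_eq (by ring))
    rw [e2]
    refine (norm_add_le _ _).trans ((add_le_add b1 b2).trans (le_of_eq (by ring)))

end IsExtendedC0Semigroup

/-! ### The linear constrained system -/

theorem applyPartial_of_mem {E : Type*} [NormedAddCommGroup E] [NormedSpace ℝ E] {B : E →ₗ.[ℝ] E}
    {x : E} (h : x ∈ B.domain) : applyPartial B x = B ⟨x, h⟩ := dif_pos h

namespace ConstrainedSystem

variable {X Q : Type*} [NormedAddCommGroup X] [NormedSpace ℝ X]
  [NormedAddCommGroup Q] [NormedSpace ℝ Q] (P : ConstrainedSystem X Q)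

/-- The projection `P₀` as an operator with values in `X₀`. -/
def proj₀ : X →L[ℝ] P.X₀ := P.P₀.codRestrict P.X₀ P.P₀_mem

theorem coe_proj₀ (x : X) : (P.proj₀ x : X) = P.P₀ x := rfl

theorem P₀_apply (x : X) : P.P₀ x = x - P.Dinv (P.D x) := rfl

theorem proj₀_coe (z : P.X₀) : P.proj₀ z = z := by
  have h : P.D (z : X) = 0 := z.2
  exact Subtype.ext (by rw [coe_proj₀, P₀_apply, h, map_zero, sub_zero])

theorem P₀_Dinv (r : Q) : P.P₀ (P.Dinv r) = 0 := by
  rw [P₀_apply, P.D_Dinv, sub_self]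

theorem proj₀_Dinv (r : Q) : P.proj₀ (P.Dinv r) = 0 :=
  Subtype.ext (P.P₀_Dinv r)

theorem proj₀_add_Dinv (x : X) : (P.proj₀ x : X) + P.Dinv (P.D x) = x := by
  rw [coe_proj₀, P₀_apply, sub_add_cancel]

theorem D_coe (z : P.X₀) : P.D (z : X) = 0 := z.2

theorem coe_proj₀_sub {x y : X} (h : P.D x = P.D y) : (P.proj₀ x - P.proj₀ y : P.X₀) = x - y := by
  rw [AddSubgroupClass.coe_sub, coe_proj₀, coe_proj₀, P₀_apply, P₀_apply, h]
  abel

theorem isClosed_X₀ : IsClosed (P.X₀ : Set X) := P.D.isClosed_ker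

instance [CompleteSpace X] : CompleteSpace P.X₀ := P.isClosed_X₀.completeSpace_coe

theorem mem_graph_A₀ {z y : P.X₀} :
    (z, y) ∈ P.A₀.graph ↔
      (z : X) ∈ P.A.domain ∧ P.proj₀ (applyPartial P.A z) = y := by
  rw [LinearPMap.mem_graph_iff]
  constructor
  · rintro ⟨w, rfl, rfl⟩
    have hw : ((w : P.X₀) : X) ∈ P.A.domain := w.2
    refine ⟨hw, ?_⟩
    rw [applyPartial_of_mem hw]
    rfl
  · rintro ⟨hz, rfl⟩
    refine ⟨⟨z, hz⟩, rfl, ?_⟩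
    rw [applyPartial_of_mem hz]
    rfl

variable {P}

/-- The total inhomogeneity of a linear constrained system. -/
def inhomogeneity (P : ConstrainedSystem X Q) (g : ℝ → X) (γ : ℝ → Q) (s : ℝ) : X :=
  applyPartial P.A (P.Dinv (γ s)) + g s

theorem intervalIntegrable_proj₀ {g : ℝ → X} {a b : ℝ}
    (hg : IntervalIntegrable g MeasureTheory.volume a b) :
    IntervalIntegrable (fun s => P.proj₀ (g s)) MeasureTheory.volume a b := by
  rw [intervalIntegrable_iff] at hg ⊢
  exact P.proj₀.integrable_comp hg

/-- The data `A D⁻ G + F` of the system are integrable on subintervals of `[0, T]`. -/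
theorem Assumptions.intervalIntegrable_inhomogeneity {u : ℝ → X} (hP : P.Assumptions u) {t σ : ℝ}
    (ht : 0 ≤ t) (hσ : 0 ≤ σ) (hT : t + σ ≤ P.T) {q : ℝ → X} (hq : ContinuousOn q (Icc 0 σ)) :
    IntervalIntegrable (P.inhomogeneity (fun s => P.F (t + s) + q s) fun s => P.G (t + s))
      MeasureTheory.volume 0 σ := by
  have h1 : IntervalIntegrable (fun s => applyPartial P.A (P.Dinv (P.G s)) + P.F s)
      MeasureTheory.volume (t + 0) (t + σ) := by
    rw [intervalIntegrable_iff_integrableOn_Icc_of_le (by linarith)]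
    have hsub : Icc (t + 0) (t + σ) ⊆ Icc 0 P.T := Icc_subset_Icc (by linarith) hT
    exact (hP.ADinvG_integrable.mono_set hsub).add
      (hP.F_continuous.mono hsub).integrableOn_Icc
  have h0 : IntervalIntegrable (fun s => applyPartial P.A (P.Dinv (P.G (t + s))) + P.F (t + s))
      MeasureTheory.volume 0 σ := by simpa using h1.comp_add_left t
  have h2 := h0.add (ContinuousOn.intervalIntegrable (u := q) (μ := MeasureTheory.volume)
      (by rwa [uIcc_of_le hσ]))
  refine h2.congr fun s _ => ?_
  simp only [inhomogeneity, add_assoc]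

theorem Assumptions.continuousOn_f_comp {u : ℝ → X} (hP : P.Assumptions u) {t σ : ℝ}
    (ht : 0 ≤ t) (hT : t + σ ≤ P.T) : ContinuousOn (fun s => P.f (u (t + s))) (Icc 0 σ) :=
  hP.fu_smooth.continuousOn.comp (by fun_prop)
    fun s hs => ⟨by linarith [hs.1], by linarith [hs.2]⟩

variable [CompleteSpace X] {S : ℝ → P.X₀ →L[ℝ] P.X₀}

theorem coe_integral (z : ℝ → P.X₀) {a b : ℝ}
    (hz : IntervalIntegrable z MeasureTheory.volume a b) :
    ((∫ s in a..b, z s : P.X₀) : X) = ∫ s in a..b, (z s : X) :=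
  (P.X₀.subtypeL.intervalIntegral_comp_comm hz).symm

theorem proj₀_integral {g : ℝ → X} {a b : ℝ} (hg : IntervalIntegrable g MeasureTheory.volume a b) :
    P.proj₀ (∫ s in a..b, g s) = ∫ s in a..b, P.proj₀ (g s) :=
  (P.proj₀.intervalIntegral_comp_comm hg).symm

/-- Every solution of the linear constrained system is given by the variation of constants formula
on `X₀`: the equation projected by `P₀` no longer contains the multiplier. -/
theorem IsSolution.proj₀_eq (hS : IsExtendedC0Semigroup S) (hB : IsGeneratorOf P.A₀ S) {h : ℝ}
    {g : ℝ → X} {γ : ℝ → Q} {x : X} {v : ℝ → X} (hv : P.IsSolution h g γ x v)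
    (hi : IntervalIntegrable (P.inhomogeneity g γ) MeasureTheory.volume 0 h) :
    ∀ t ∈ Icc 0 h, P.proj₀ (v t) =
      S t (P.proj₀ x) + duhamel S (fun s => P.proj₀ (P.inhomogeneity g γ s)) t := by
  intro t ht
  obtain ⟨hvc, -, Λ, hΛ⟩ := hv
  have hh : 0 ≤ h := ht.1.trans ht.2
  set k : ℝ → P.X₀ := fun s => P.proj₀ (P.inhomogeneity g γ s) with hk
  have hki : IntervalIntegrable k MeasureTheory.volume 0 h := intervalIntegrable_proj₀ hi
  have hpv : ContinuousOn (fun s => P.proj₀ (v s)) (Icc 0 h) :=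
    P.proj₀.continuous.comp_continuousOn hvc
  have hsc : ContinuousOn (fun s => S s (P.proj₀ x) + duhamel S k s) (Icc 0 h) :=
    (hS.continuous_apply _).continuousOn.add (hS.continuousOn_duhamel hh hki)
  have hz := hS.eq_zero_of_integral_mem_graph hB
    (y := fun s => P.proj₀ (v s) - (S s (P.proj₀ x) + duhamel S k s)) (hpv.sub hsc) ?_ t ht
  · exact sub_eq_zero.1 hz
  intro r hr
  have hsub : uIcc 0 r ⊆ Icc 0 h := by rw [uIcc_of_le hr.1]; exact Icc_subset_Icc_right hr.2
  have hsub' : uIcc 0 r ⊆ uIcc 0 h := by rwa [uIcc_of_le hh]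
  have hpvi : IntervalIntegrable (fun s => P.proj₀ (v s)) MeasureTheory.volume 0 r :=
    (hpv.mono hsub).intervalIntegrable
  rw [intervalIntegral.integral_sub hpvi (hsc.mono hsub).intervalIntegrable]
  obtain ⟨hmem, heq⟩ := hΛ r hr
  have h1 : (∫ s in (0 : ℝ)..r, P.proj₀ (v s),
      P.proj₀ (v r) - P.proj₀ x - ∫ s in (0 : ℝ)..r, k s) ∈ P.A₀.graph := by
    rw [mem_graph_A₀, coe_integral _ hpvi]
    refine ⟨hmem, ?_⟩
    have h2 := congrArg P.proj₀ heq
    rw [map_add, map_add, map_add, proj₀_Dinv, add_zero] at h2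
    rw [h2, hk, ← proj₀_integral (hi.mono_set hsub')]
    simp only [coe_proj₀, inhomogeneity]
    abel
  have h2 := hS.integral_mild_mem_graph hB hr.1 (hki.mono_set hsub') (P.proj₀ x)
  have h3 := P.A₀.graph.sub_mem h1 h2
  convert h3 using 1
  refine Prod.ext rfl ?_
  simp only [Prod.snd_sub]
  abel

/-- The variation of constants formula defines a solution of the linear constrained system. -/
theorem exists_isSolution (hS : IsExtendedC0Semigroup S) (hB : IsGeneratorOf P.A₀ S) {h : ℝ}
    (hh : 0 ≤ h) {g : ℝ → X} {γ : ℝ → Q} (x : X) (hγ : ContinuousOn γ (Icc 0 h))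
    (hi : IntervalIntegrable (P.inhomogeneity g γ) MeasureTheory.volume 0 h) :
    ∃ v, P.IsSolution h g γ x v := by
  set k : ℝ → P.X₀ := fun s => P.proj₀ (P.inhomogeneity g γ s) with hk
  have hki : IntervalIntegrable k MeasureTheory.volume 0 h := intervalIntegrable_proj₀ hi
  set z : ℝ → P.X₀ := fun s => S s (P.proj₀ x) + duhamel S k s with hz
  have hzc : ContinuousOn z (Icc 0 h) :=
    (hS.continuous_apply _).continuousOn.add (hS.continuousOn_duhamel hh hki)
  have hP₀ : ∀ s, P.P₀ ((z s : X) + P.Dinv (γ s)) = z s := fun s => by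
    rw [map_add, P₀_Dinv, add_zero, ← coe_proj₀, proj₀_coe]
  refine ⟨fun t => (z t : X) + P.Dinv (γ t),
    (continuous_subtype_val.comp_continuousOn hzc).add (P.Dinv.continuous.comp_continuousOn hγ),
    fun t _ => by rw [map_add, D_coe, P.D_Dinv, zero_add],
    fun t => P.D (x + applyPartial P.A (∫ s in (0 : ℝ)..t, P.P₀ ((z s : X) + P.Dinv (γ s)))
      + ∫ s in (0 : ℝ)..t, (applyPartial P.A (P.Dinv (γ s)) + g s)) - γ t, fun r hr => ?_⟩
  have hsub : uIcc 0 r ⊆ Icc 0 h := by rw [uIcc_of_le hr.1]; exact Icc_subset_Icc_right hr.2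
  have hsub' : uIcc 0 r ⊆ uIcc 0 h := by rwa [uIcc_of_le hh]
  have h2 := hS.integral_mild_mem_graph hB hr.1 (hki.mono_set hsub') (P.proj₀ x)
  rw [mem_graph_A₀, coe_integral _ (hzc.mono hsub).intervalIntegrable] at h2
  simp only [hP₀]
  refine ⟨h2.1, ?_⟩
  set w := x + applyPartial P.A (∫ s in (0 : ℝ)..r, (z s : X))
    + ∫ s in (0 : ℝ)..r, (applyPartial P.A (P.Dinv (γ s)) + g s) with hw
  have h3 : P.proj₀ w = z r := by
    rw [hw, map_add, map_add, h2.2]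
    have : P.proj₀ (∫ s in (0 : ℝ)..r, (applyPartial P.A (P.Dinv (γ s)) + g s))
        = ∫ s in (0 : ℝ)..r, k s := proj₀_integral (hi.mono_set hsub')
    rw [this]
    change _ = S r (P.proj₀ x) + duhamel S k r
    abel
  calc (z r : X) + P.Dinv (γ r) + P.Dinv (P.D w - γ r) = (z r : X) + P.Dinv (P.D w) := by
        rw [map_sub]; abel
    _ = w := by rw [← h3, proj₀_add_Dinv]

theorem Assumptions.u_zero {u : ℝ → X} (hP : P.Assumptions u) (hS : IsExtendedC0Semigroup S)
    (hB : IsGeneratorOf P.A₀ S) : u 0 = P.u₀ := by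
  have h0 : (0 : ℝ) ∈ Icc 0 P.T := ⟨le_rfl, hP.T_pos.le⟩
  have h1 := hP.u_solution.proj₀_eq hS hB (by
    simpa using hP.intervalIntegrable_inhomogeneity le_rfl hP.T_pos.le (zero_add P.T).le
      hP.fu_smooth.continuousOn) 0 h0
  have h2 : P.D (u 0) = P.D P.u₀ := by rw [hP.u_solution.2.1 0 h0, hP.u₀_consistent]
  rw [hS.map_zero_apply, duhamel, intervalIntegral.integral_same, add_zero] at h1
  rw [← sub_eq_zero, ← P.coe_proj₀_sub h2, h1, sub_self]
  rfl

/-- The exact solution can be restarted at any time. -/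
theorem Assumptions.proj₀_add {u : ℝ → X} (hP : P.Assumptions u) (hS : IsExtendedC0Semigroup S)
    (hB : IsGeneratorOf P.A₀ S) {t σ : ℝ} (ht : 0 ≤ t) (hσ : 0 ≤ σ) (hT : t + σ ≤ P.T) :
    P.proj₀ (u (t + σ)) = S σ (P.proj₀ (u t)) + duhamel S (fun s => P.proj₀ (P.inhomogeneity
      (fun s => P.F (t + s) + P.f (u (t + s))) (fun s => P.G (t + s)) s)) σ := by
  have hi : IntervalIntegrable (P.inhomogeneity (fun s => P.F s + P.f (u s)) P.G)
      MeasureTheory.volume 0 P.T := by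
    simpa using hP.intervalIntegrable_inhomogeneity le_rfl hP.T_pos.le (zero_add P.T).le
      hP.fu_smooth.continuousOn
  have h := hP.u_solution.proj₀_eq hS hB hi
  rw [h (t + σ) ⟨by linarith, hT⟩, h t ⟨ht, by linarith⟩, map_add,
    hS.duhamel_add ht hσ ((intervalIntegrable_proj₀ hi).mono_set (by
      rw [uIcc_of_le (by linarith), uIcc_of_le hP.T_pos.le]; exact Icc_subset_Icc_right hT)),
    add_comm t σ, hS.map_add_apply hσ ht, add_assoc]
  rfl

/-- The linear constrained flow with `q` in place of `f(u)`, compared with the exact solution. Both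
satisfy the same constraint, so that the difference lies in `X₀` and `A D⁻ G + F` drops out. -/
theorem IsSolution.sub_eq {u : ℝ → X} (hP : P.Assumptions u) (hS : IsExtendedC0Semigroup S)
    (hB : IsGeneratorOf P.A₀ S) {t σ : ℝ} (ht : 0 ≤ t) (hσ : 0 ≤ σ) (hT : t + σ ≤ P.T)
    {q v : ℝ → X} {x : X} (hq : ContinuousOn q (Icc 0 σ))
    (hv : P.IsSolution σ (fun s => P.F (t + s) + q s) (fun s => P.G (t + s)) x v) :
    P.proj₀ (v σ) - P.proj₀ (u (t + σ)) = S σ (P.proj₀ x - P.proj₀ (u t))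
        + duhamel S (fun s => P.proj₀ (q s - P.f (u (t + s)))) σ ∧
      P.D (v σ) = P.D (u (t + σ)) := by
  have hσ' : σ ∈ Icc 0 σ := ⟨hσ, le_rfl⟩
  have hi := hP.intervalIntegrable_inhomogeneity ht hσ hT hq
  have hi' := hP.intervalIntegrable_inhomogeneity ht hσ hT (hP.continuousOn_f_comp ht hT)
  refine ⟨?_, ?_⟩
  · rw [hv.proj₀_eq hS hB hi σ hσ', hP.proj₀_add hS hB ht hσ hT, map_sub, add_sub_add_comm]
    congr 1
    rw [duhamel, duhamel, duhamel, ← intervalIntegral.integral_sub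
      (hS.intervalIntegrable_apply σ (intervalIntegrable_proj₀ hi))
      (hS.intervalIntegrable_apply σ (intervalIntegrable_proj₀ hi'))]
    refine intervalIntegral.integral_congr fun s _ => ?_
    simp only [← map_sub, inhomogeneity, add_sub_add_left_eq_sub]
  · rw [hv.2.1 σ hσ', hP.u_solution.2.1 (t + σ) ⟨by linarith, hT⟩]

theorem Assumptions.exists_linear_step {u : ℝ → X} (hP : P.Assumptions u)
    (hS : IsExtendedC0Semigroup S) (hB : IsGeneratorOf P.A₀ S) {t σ : ℝ} (ht : 0 ≤ t)
    (hσ : 0 ≤ σ) (hT : t + σ ≤ P.T) {q : ℝ → X} (hq : ContinuousOn q (Icc 0 σ)) (x : X) :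
    ∃ v, P.IsSolution σ (fun s => P.F (t + s) + q s) (fun s => P.G (t + s)) x v := by
  obtain ⟨K, hK⟩ := hP.G_lipschitz
  exact exists_isSolution hS hB hσ x (hK.continuousOn.comp (by fun_prop)
    fun s hs => ⟨by linarith [hs.1], by linarith [hs.2]⟩)
    (hP.intervalIntegrable_inhomogeneity ht hσ hT hq)

end ConstrainedSystem

/-! ### Uniform bounds and the nonlinear substep -/

namespace ConstrainedSystem

variable {X Q : Type*} [NormedAddCommGroup X] [NormedSpace ℝ X]
  [NormedAddCommGroup Q] [NormedSpace ℝ Q] {P : ConstrainedSystem X Q}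

theorem IsCorrection.mono {u : ℝ → X} {M K τ t : ℝ} {q : ℝ → X} (hq : P.IsCorrection u M τ t q)
    (hτ : 0 ≤ τ) (hMK : M ≤ K) : P.IsCorrection u K τ t q where
  contDiffOn := hq.contDiffOn
  bound k hk s hs := (hq.bound k hk s hs).trans hMK
  smooth := hq.smooth
  smooth_P₀ := hq.smooth_P₀
  bound_P₀ s hs := (hq.bound_P₀ s hs).trans hMK
  consistent := hq.consistent.trans (by gcongr)

theorem IsCorrection.norm_le {u : ℝ → X} {M τ t : ℝ} {q : ℝ → X} (hq : P.IsCorrection u M τ t q) :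
    ∀ s ∈ Icc 0 τ, ‖q s‖ ≤ M := fun s hs => by
  simpa using hq.bound 0 (by norm_num) s hs

theorem IsCorrection.norm_sub_le {u : ℝ → X} {M τ t : ℝ} {q : ℝ → X}
    (hq : P.IsCorrection u M τ t q) :
    ∀ s ∈ Icc 0 τ, ∀ r ∈ Icc 0 τ, ‖q s - q r‖ ≤ M * |s - r| := by
  intro s hs r hr
  refine Convex.norm_image_sub_le_of_norm_hasDerivWithin_le (f' := derivWithin q (Icc 0 τ))
    (fun s hs => ((hq.contDiffOn.differentiableOn (by norm_num)) s hs).hasDerivWithinAt)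
    (fun s hs => ?_) (convex_Icc 0 τ) hr hs
  rw [← iteratedDerivWithin_one]
  exact hq.bound 1 (by norm_num) s hs

/-- A single constant `K ≥ 1` that serves as a bound for all the quantities the error analysis
involves: the semigroup on `[0, T]` and its smoothing property, `f` and `f'` in the
`δ`-neighbourhood of the exact solution, `f(u)` and its derivative, and the operators `P₀`, `D`, `D⁻`. -/
structure UniformBounds (P : ConstrainedSystem X Q) (u : ℝ → X) (S : ℝ → P.X₀ →L[ℝ] P.X₀)
    (g' : ℝ → X) (δ K : ℝ) : Prop where
  one_le : 1 ≤ K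
  norm_S : ∀ t ≤ P.T, ‖S t‖ ≤ K
  norm_S_sub : ∀ t a b, 0 < t → t ≤ a → a ≤ P.T → t ≤ b → b ≤ P.T →
    ‖S a - S b‖ ≤ K * |a - b| / t
  near : ∀ t ∈ Icc 0 P.T, ∀ x, ‖x - u t‖ ≤ δ → ‖P.f x‖ ≤ K ∧ ‖fderiv ℝ P.f x‖ ≤ K ∧
    ∀ z, ‖z - u t‖ ≤ δ → ‖P.f x - P.f z‖ ≤ K * ‖x - z‖ ∧
      ‖fderiv ℝ P.f x - fderiv ℝ P.f z‖ ≤ K * ‖x - z‖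
  deriv_fu : ∀ t ∈ Icc 0 P.T, HasDerivWithinAt (fun t => P.f (u t)) (g' t) (Icc 0 P.T) t
  norm_deriv_fu : ∀ t ∈ Icc 0 P.T, ‖g' t‖ ≤ K
  norm_deriv_fu_sub : ∀ s ∈ Icc 0 P.T, ∀ t ∈ Icc 0 P.T, ‖g' s - g' t‖ ≤ K * |s - t|
  norm_proj₀ : ‖P.proj₀‖ ≤ K
  norm_D : ‖P.D‖ ≤ K
  norm_Dinv : ‖P.Dinv‖ ≤ K

theorem Assumptions.exists_uniformBounds [CompleteSpace X] {u : ℝ → X} (hP : P.Assumptions u)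
    {S : ℝ → P.X₀ →L[ℝ] P.X₀} (hS : IsExtendedC0Semigroup S) (hA : IsAnalyticSemigroup S) (M : ℝ) :
    ∃ (g' : ℝ → X) (δ K : ℝ), 0 < δ ∧ M ≤ K ∧ P.UniformBounds u S g' δ K := by
  obtain ⟨K₁, -, h1⟩ := hS.exists_bound P.T
  obtain ⟨K₂, -, h2⟩ := hA.exists_norm_sub_le hS P.T
  obtain ⟨δ, K₃, hδ, hK₃, h3⟩ := (isCompact_Icc.image_of_continuousOn
    hP.u_solution.1).exists_uniform_bounds hP.f_diff hP.f_diff_two hP.f_second_locally_bounded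
  obtain ⟨g', K₄, h4, h5, h6⟩ := hP.fu_smooth.exists_deriv_bounds hP.T_pos
  have hn1 : 0 ≤ K₁ := (norm_nonneg _).trans (h1 0 hP.T_pos.le)
  have hn4 : 0 ≤ K₄ := (norm_nonneg _).trans (h5 0 ⟨le_rfl, hP.T_pos.le⟩)
  have hn5 := norm_nonneg P.proj₀
  have hn6 := norm_nonneg P.D
  have hn7 := norm_nonneg P.Dinv
  obtain ⟨K, hK⟩ : ∃ K, K = 1 + K₁ + |K₂| + K₃ + K₄ + ‖P.proj₀‖ + ‖P.D‖ + ‖P.Dinv‖ + |M| := ⟨_, rfl⟩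
  have hn2 := abs_nonneg K₂
  have hn8 := abs_nonneg M
  have hK3 : K₃ ≤ K := by linarith
  have hK4 : K₄ ≤ K := by linarith
  have hK2 : K₂ ≤ K := by linarith [le_abs_self K₂]
  refine ⟨g', δ, K, hδ, by linarith [le_abs_self M], by linarith,
    fun t ht => (h1 t ht).trans (by linarith), ?_, ?_, h4, fun t ht => (h5 t ht).trans hK4,
    fun s hs t ht => (h6 s hs t ht).trans (by gcongr), by linarith, by linarith, by linarith⟩
  · intro t a b ht h1 h2' h3 h4
    exact (h2 t a b ht h1 h2' h3 h4).trans (by gcongr)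
  · intro t ht x hx
    obtain ⟨a, b, c⟩ := h3 (u t) (mem_image_of_mem u ht) x hx
    refine ⟨a.trans hK3, b.trans hK3, fun z hz => ⟨(c z hz).1.trans ?_, (c z hz).2.trans ?_⟩⟩ <;>
      gcongr

namespace UniformBounds

variable {u : ℝ → X} {S : ℝ → P.X₀ →L[ℝ] P.X₀} {g' : ℝ → X} {δ K : ℝ}

theorem pos (h : P.UniformBounds u S g' δ K) : 0 < K := one_pos.trans_le h.one_le

theorem norm_fu_le (h : P.UniformBounds u S g' δ K) (hδ : 0 < δ) :
    ∀ t ∈ Icc 0 P.T, ‖P.f (u t)‖ ≤ K := fun t ht =>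
  (h.near t ht (u t) (by simpa using hδ.le)).1

theorem norm_fu_sub_le (h : P.UniformBounds u S g' δ K) :
    ∀ s ∈ Icc 0 P.T, ∀ t ∈ Icc 0 P.T, ‖P.f (u s) - P.f (u t)‖ ≤ K * |s - t| := fun _ hs _ ht =>
  Convex.norm_image_sub_le_of_norm_hasDerivWithin_le h.deriv_fu h.norm_deriv_fu (convex_Icc 0 P.T)
    ht hs

/-- The correction error `ψ = q - f(u)` of a step, with its bound, its Lipschitz constant and its
almost consistency with the constraint. -/
theorem correction_error (h : P.UniformBounds u S g' δ K) (hδ : 0 < δ) {τ t : ℝ} {q : ℝ → X}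
    (hq : P.IsCorrection u K τ t q) (hτ : 0 ≤ τ) (ht : 0 ≤ t) (hT : t + τ ≤ P.T) :
    (∀ s ∈ Icc 0 τ, ‖q s - P.f (u (t + s))‖ ≤ 2 * K) ∧
    (∀ s ∈ Icc 0 τ, ∀ r ∈ Icc 0 τ,
      ‖(q s - P.f (u (t + s))) - (q r - P.f (u (t + r)))‖ ≤ 2 * K * |s - r|) ∧
    ∀ s ∈ Icc 0 τ, ‖P.Dinv (P.D (q s - P.f (u (t + s))))‖ ≤ 3 * K ^ 3 * τ := by
  have hmem : ∀ s ∈ Icc 0 τ, t + s ∈ Icc 0 P.T := fun s hs =>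
    ⟨by linarith [hs.1], by linarith [hs.2]⟩
  have hK := h.pos
  have hK1 := h.one_le
  have hlip : ∀ s ∈ Icc 0 τ, ∀ r ∈ Icc 0 τ,
      ‖(q s - P.f (u (t + s))) - (q r - P.f (u (t + r)))‖ ≤ 2 * K * |s - r| := by
    intro s hs r hr
    have h1 := hq.norm_sub_le s hs r hr
    have h2 := h.norm_fu_sub_le _ (hmem s hs) _ (hmem r hr)
    rw [add_sub_add_left_eq_sub] at h2
    rw [sub_sub_sub_comm]
    refine (norm_sub_le _ _).trans ?_
    linarith
  refine ⟨fun s hs => ?_, hlip, fun s hs => ?_⟩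
  · refine (norm_sub_le _ _).trans ?_
    linarith [hq.norm_le s hs, h.norm_fu_le hδ _ (hmem s hs)]
  · have h0 : (0 : ℝ) ∈ Icc 0 τ := ⟨le_rfl, hτ⟩
    have h1 := hlip s hs 0 h0
    rw [sub_zero, abs_of_nonneg hs.1, add_zero] at h1
    have h2 : ‖P.D (q 0 - P.f (u t))‖ ≤ K * τ := by rw [map_sub]; exact hq.consistent
    have h3 : ‖P.D (q s - P.f (u (t + s)))‖ ≤ 3 * K ^ 2 * τ := by
      have e : P.D (q s - P.f (u (t + s))) = P.D ((q s - P.f (u (t + s))) - (q 0 - P.f (u t)))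
          + P.D (q 0 - P.f (u t)) := by rw [← map_add, sub_add_cancel]
      rw [e]
      refine (norm_add_le _ _).trans ?_
      have h4 := P.D.le_of_opNorm_le_of_le h.norm_D h1
      have h5 : K * (2 * K * s) ≤ 2 * K ^ 2 * τ := by
        calc K * (2 * K * s) = 2 * K ^ 2 * s := by ring
          _ ≤ _ := by gcongr; exact hs.2
      have h6 : K * τ ≤ K ^ 2 * τ := by gcongr; nlinarith
      linarith
    refine (P.Dinv.le_of_opNorm_le_of_le h.norm_Dinv h3).trans (le_of_eq (by ring))

theorem proj₀_error (h : P.UniformBounds u S g' δ K) (hδ : 0 < δ)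
    (hq : P.IsCorrection u K τ t q) (hτ : 0 ≤ τ) (ht : 0 ≤ t) (hT : t + τ ≤ P.T) :
    (∀ s ∈ Icc 0 τ, ‖P.proj₀ (q s - P.f (u (t + s)))‖ ≤ 2 * K ^ 2) ∧
    (∀ s ∈ Icc 0 τ, ∀ r ∈ Icc 0 τ,
      ‖P.proj₀ (q s - P.f (u (t + s))) - P.proj₀ (q r - P.f (u (t + r)))‖
        ≤ 2 * K ^ 2 * |s - r|) ∧
    ∀ s ∈ Icc 0 τ, ∃ z, (P.proj₀ (q s - P.f (u (t + s))), z) ∈ P.A₀.graph ∧ ‖z‖ ≤ K := by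
  obtain ⟨h1, h2, -⟩ := h.correction_error hδ hq hτ ht hT
  refine ⟨fun s hs => ?_, fun s hs r hr => ?_, fun s hs => ?_⟩
  · exact (P.proj₀.le_of_opNorm_le_of_le h.norm_proj₀ (h1 s hs)).trans (le_of_eq (by ring))
  · rw [← map_sub]
    exact (P.proj₀.le_of_opNorm_le_of_le h.norm_proj₀ (h2 s hs r hr)).trans (le_of_eq (by ring))
  · exact ⟨_, P.mem_graph_A₀.2 ⟨hq.smooth_P₀ s hs, rfl⟩, hq.bound_P₀ s hs⟩

theorem norm_duhamel_le (h : P.UniformBounds u S g' δ K)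
    {φ : ℝ → P.X₀} {σ C : ℝ} (hσ : 0 ≤ σ) (hσT : σ ≤ P.T) (hφ : ∀ s ∈ Icc 0 σ, ‖φ s‖ ≤ C) :
    ‖duhamel S φ σ‖ ≤ K * C * σ := by
  refine (intervalIntegral.norm_integral_le_of_norm_le_const (C := K * C)
    fun s hs => ?_).trans (le_of_eq ?_)
  · rw [uIoc_of_le hσ] at hs
    exact (S (σ - s)).le_of_opNorm_le_of_le (h.norm_S _ (by linarith [hs.1]))
      (hφ s ⟨hs.1.le, hs.2⟩)
  · rw [sub_zero, abs_of_nonneg hσ]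

variable [CompleteSpace X]

/-- The nonlinear substep: if it starts close enough to `u(t + τ / 2)`, it stays in the
neighbourhood where the uniform bounds hold, and `f(w)` obeys the midpoint rule. -/
theorem nonlinear_step (h : P.UniformBounds u S g' δ K) (hf : Differentiable ℝ P.f) {τ t : ℝ}
    {q w : ℝ → X} (hq : P.IsCorrection u K τ t q) {r : ℝ} (hτ : 0 ≤ τ) (hr : r ∈ Icc 0 P.T)
    (hw : ∀ s ∈ Icc 0 τ, HasDerivWithinAt w (P.f (w s) - q s) (Icc 0 τ) s)
    (h0 : ‖w 0 - u r‖ + (2 * K + 1) * τ ≤ δ) :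
    (∀ s ∈ Icc 0 τ, ‖w s - w 0‖ ≤ (2 * K + 1) * s ∧ ‖w s - u r‖ ≤ δ) ∧
    ‖(∫ s in (0 : ℝ)..τ, P.f (w s)) - τ • P.f (w (τ / 2))‖ ≤ 7 * K ^ 3 * τ ^ 3 := by
  have hK := h.pos
  have hK1 := h.one_le
  have hb : ∀ s ∈ Icc 0 τ, ‖w s - u r‖ ≤ δ → ‖P.f (w s) - q s‖ ≤ 2 * K := by
    intro s hs hws
    refine (_root_.norm_sub_le _ _).trans ?_
    linarith [(h.near r hr (w s) hws).1, hq.norm_le s hs]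
  have hball := norm_sub_le_of_hasDerivWithinAt_of_bound (by positivity) hw hb h0
  refine ⟨hball, ?_⟩
  have hlip : ∀ s ∈ Icc 0 τ, ∀ r ∈ Icc 0 τ, ‖w s - w r‖ ≤ 2 * K * |s - r| := fun s hs r hr =>
    Convex.norm_image_sub_le_of_norm_hasDerivWithin_le hw (fun s hs => hb s hs (hball s hs).2)
      (convex_Icc 0 τ) hr hs
  have := norm_integral_sub_midpoint_le (g := fun s => P.f (w s))
    (g' := fun s => fderiv ℝ P.f (w s) (P.f (w s) - q s)) (L := 7 * K ^ 3) hτ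
    (fun s hs => (hf (w s)).hasFDerivAt.comp_hasDerivWithinAt s (hw s hs)) fun s hs r' hr' => by
      have h1 := (h.near r hr (w s) (hball s hs).2).2.2 (w r') (hball r' hr').2
      have h2 := hlip s hs r' hr'
      have h3 := hb s hs (hball s hs).2
      have h4 := hq.norm_sub_le s hs r' hr'
      have h5 := (h.near r hr (w r') (hball r' hr').2).2.1
      have e : fderiv ℝ P.f (w s) (P.f (w s) - q s) - fderiv ℝ P.f (w r') (P.f (w r') - q r')
          = (fderiv ℝ P.f (w s) - fderiv ℝ P.f (w r')) (P.f (w s) - q s)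
            + fderiv ℝ P.f (w r') ((P.f (w s) - P.f (w r')) - (q s - q r')) := by
        simp only [sub_apply, map_sub]; abel
      have b1 : ‖P.f (w s) - P.f (w r')‖ ≤ 2 * K ^ 2 * |s - r'| :=
        h1.1.trans (by calc K * ‖w s - w r'‖ ≤ K * (2 * K * |s - r'|) := by gcongr
                         _ = _ := by ring)
      have b2 : ‖fderiv ℝ P.f (w s) - fderiv ℝ P.f (w r')‖ ≤ 2 * K ^ 2 * |s - r'| :=
        h1.2.trans (by calc K * ‖w s - w r'‖ ≤ K * (2 * K * |s - r'|) := by gcongr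
                         _ = _ := by ring)
      have b3 := ContinuousLinearMap.le_of_opNorm_le_of_le _ b2 h3
      have b4 := ContinuousLinearMap.le_of_opNorm_le_of_le _ h5
        ((_root_.norm_sub_le _ _).trans (add_le_add b1 h4))
      rw [e]
      refine (norm_add_le _ _).trans ((add_le_add b3 b4).trans ?_)
      have b5 : K ^ 2 * |s - r'| ≤ K ^ 3 * |s - r'| := by
        gcongr
        norm_num
      linarith [show 2 * K ^ 2 * |s - r'| * (2 * K) + K * (2 * K ^ 2 * |s - r'| + K * |s - r'|)
        = 6 * (K ^ 3 * |s - r'|) + K ^ 2 * |s - r'| by ring]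
  rwa [abs_of_nonneg (by positivity)] at this

end UniformBounds
end ConstrainedSystem

/-! ### The error of one step -/

namespace ConstrainedSystem

variable {X Q : Type*} [NormedAddCommGroup X] [NormedSpace ℝ X] [CompleteSpace X]
  [NormedAddCommGroup Q] [NormedSpace ℝ Q] {P : ConstrainedSystem X Q}

namespace UniformBounds

variable {u : ℝ → X} {S : ℝ → P.X₀ →L[ℝ] P.X₀} {g' : ℝ → X} {δ K τ t : ℝ} {q : ℝ → X} {x y : X}

/-- The first linear substep, compared with the exact solution. -/
theorem first_substep (h : P.UniformBounds u S g' δ K) (hδ : 0 < δ) (hP : P.Assumptions u)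
    (hS : IsExtendedC0Semigroup S) (hB : IsGeneratorOf P.A₀ S)
    (hq : P.IsCorrection u K τ t q) (hτ : 0 ≤ τ) (ht : 0 ≤ t) (hT : t + τ ≤ P.T) {v : ℝ → X}
    (hv : P.IsSolution (τ / 2) (fun s => P.F (t + s) + q s) (fun s => P.G (t + s)) x v) :
    v (τ / 2) - u (t + τ / 2) = (S (τ / 2) (P.proj₀ x - P.proj₀ (u t))
        + duhamel S (fun s => P.proj₀ (q s - P.f (u (t + s)))) (τ / 2) : P.X₀) ∧
    ‖v (τ / 2) - u (t + τ / 2)‖ ≤ K * ‖P.proj₀ x - P.proj₀ (u t)‖ + K ^ 3 * τ := by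
  have hm : τ / 2 ≤ τ := by linarith
  have hK := h.pos
  obtain ⟨h1, h2⟩ := hv.sub_eq hP hS hB ht (by positivity) (by linarith)
    (hq.contDiffOn.continuousOn.mono (Icc_subset_Icc_right hm))
  rw [← P.coe_proj₀_sub h2, h1]
  refine ⟨rfl, (norm_add_le _ _).trans (add_le_add ?_ ?_)⟩
  · exact (S (τ / 2)).le_of_opNorm_le (h.norm_S _ (by linarith)) _
  · refine (h.norm_duhamel_le (by positivity) (by linarith) fun s hs =>
      (h.proj₀_error hδ hq hτ ht hT).1 s ⟨hs.1, hs.2.trans hm⟩).trans (le_of_eq (by ring))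

theorem exists_strangStep (h : P.UniformBounds u S g' δ K) (hδ : 0 < δ) (hP : P.Assumptions u)
    (hS : IsExtendedC0Semigroup S) (hB : IsGeneratorOf P.A₀ S)
    (hq : P.IsCorrection u K τ t q) (hτ : 0 ≤ τ) (ht : 0 ≤ t) (hT : t + τ ≤ P.T)
    (hx : K * ‖P.proj₀ x - P.proj₀ (u t)‖ + (K ^ 3 + 2 * K + 1) * τ ≤ δ) :
    ∃ y, P.IsStrangStep τ t q x y := by
  have hm : τ / 2 ≤ τ := by linarith
  have hK := h.pos
  have hqc := hq.contDiffOn.continuousOn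
  have hr : t + τ / 2 ∈ Icc 0 P.T := ⟨by positivity, by linarith⟩
  obtain ⟨v, hv⟩ := hP.exists_linear_step hS hB ht (σ := τ / 2) (by positivity) (by linarith)
    (hqc.mono (Icc_subset_Icc_right hm)) x
  have hv0 := (h.first_substep hδ hP hS hB hq hτ ht hT hv).2
  obtain ⟨w, hw0, hw⟩ := exists_hasDerivWithinAt_sub (f := P.f) (q := q) (y := u (t + τ / 2))
    (w₀ := v (τ / 2)) (δ := δ) (R := 2 * K) (L := K) hτ hqc hK.le
    (fun x z hx hz => ((h.near _ hr x hx).2.2 z hz).1)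
    (fun s hs x hx => (_root_.norm_sub_le _ _).trans
      (by linarith [(h.near _ hr x hx).1, hq.norm_le s hs])) (by positivity)
    (by linarith)
  obtain ⟨v', hv'⟩ := hP.exists_linear_step hS hB (t := t + τ / 2) (σ := τ / 2)
    (q := fun s => q (τ / 2 + s)) hr.1 (by positivity) (by linarith)
    (hqc.comp (by fun_prop) fun s hs => ⟨by linarith [hs.1], by linarith [hs.2]⟩) (w τ)
  simp only [add_assoc] at hv'
  exact ⟨v' (τ / 2), v, w, v', hv, hw0, hw, hv', rfl⟩

/-- At the midpoint of its interval the nonlinear substep is within `O(‖e‖ + τ²)` of the exact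
solution. Here the smoothness of the correction error enters through `(S (τ / 2 - s) - 1) φ(s)` and
its consistency through `D⁻ D ψ(s)`, both of which are `O(τ)`. -/
theorem norm_midpoint_sub_le (h : P.UniformBounds u S g' δ K) (hδ : 0 < δ) (hP : P.Assumptions u)
    (hS : IsExtendedC0Semigroup S) (hB : IsGeneratorOf P.A₀ S)
    (hq : P.IsCorrection u K τ t q) (hτ : 0 ≤ τ) (hτ1 : τ ≤ 1) (ht : 0 ≤ t) (hT : t + τ ≤ P.T)
    (hx : K * ‖P.proj₀ x - P.proj₀ (u t)‖ + (K ^ 3 + 2 * K + 1) * τ ≤ δ) {v w : ℝ → X}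
    (hv : P.IsSolution (τ / 2) (fun s => P.F (t + s) + q s) (fun s => P.G (t + s)) x v)
    (hw0 : w 0 = v (τ / 2))
    (hw : ∀ s ∈ Icc 0 τ, HasDerivWithinAt w (P.f (w s) - q s) (Icc 0 τ) s) :
    ‖w (τ / 2) - u (t + τ / 2)‖
      ≤ 9 * K ^ 4 * (‖P.proj₀ x - P.proj₀ (u t)‖ + τ ^ 2) := by
  have hK := h.pos
  have hK1 := h.one_le
  have hm0 : 0 ≤ τ / 2 := by positivity
  have hm : τ / 2 ≤ τ := by linarith
  have hsub : Icc 0 (τ / 2) ⊆ Icc 0 τ := Icc_subset_Icc_right hm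
  have hr : t + τ / 2 ∈ Icc 0 P.T := ⟨by positivity, by linarith⟩
  set e := P.proj₀ x - P.proj₀ (u t) with he
  set ψ : ℝ → X := fun s => q s - P.f (u (t + s)) with hψ
  have hqc := hq.contDiffOn.continuousOn
  have hgc : ContinuousOn (fun s => P.f (u (t + s))) (Icc 0 τ) := hP.continuousOn_f_comp ht hT
  have hψc : ContinuousOn ψ (Icc 0 τ) := hqc.sub hgc
  have hwc : ContinuousOn w (Icc 0 τ) := fun s hs => (hw s hs).continuousWithinAt
  have hfw : ContinuousOn (fun s => P.f (w s)) (Icc 0 τ) :=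
    hP.f_diff.continuous.comp_continuousOn hwc
  have hfg : ContinuousOn (fun s => P.f (w s) - P.f (u (t + s))) (Icc 0 τ) := hfw.sub hgc
  have hii : ∀ {k : ℝ → X}, ContinuousOn k (Icc 0 τ) →
      IntervalIntegrable k MeasureTheory.volume 0 (τ / 2) := fun hk =>
    ContinuousOn.intervalIntegrable (by rw [uIcc_of_le hm0]; exact hk.mono hsub)
  obtain ⟨hv1, hv2⟩ := h.first_substep hδ hP hS hB hq hτ ht hT hv
  obtain ⟨hball, -⟩ := h.nonlinear_step hP.f_diff hq hτ hr hw (by rw [hw0]; linarith)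
  obtain ⟨-, -, hDψ⟩ := h.correction_error hδ hq hτ ht hT
  obtain ⟨-, -, hφA⟩ := h.proj₀_error hδ hq hτ ht hT
  -- the fundamental theorem of calculus for `w`
  have hftc : w (τ / 2) - w 0 = ∫ s in (0 : ℝ)..(τ / 2), (P.f (w s) - q s) := by
    refine (intervalIntegral.integral_eq_sub_of_hasDeriv_right ?_ (fun s hs => ?_)
      (hii (hfw.sub hqc))).symm
    · rw [uIcc_of_le hm0]; exact hwc.mono hsub
    · rw [min_eq_left hm0, max_eq_right hm0] at hs
      exact (hw s ⟨hs.1.le, hs.2.le.trans hm⟩).mono_of_mem_nhdsWithin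
        (mem_of_superset (Icc_mem_nhdsGT (hs.2.trans_le hm)) (Icc_subset_Icc_left hs.1.le))
  have hφi : IntervalIntegrable (fun s => P.proj₀ (ψ s)) MeasureTheory.volume 0 (τ / 2) :=
    intervalIntegrable_proj₀ (hii hψc)
  -- the integral of `ψ`, split into its components in `X₀` and in the range of `D⁻`
  have hsplit : ∫ s in (0 : ℝ)..(τ / 2), ψ s = ((∫ s in (0 : ℝ)..(τ / 2), P.proj₀ (ψ s) : P.X₀) : X)
      + ∫ s in (0 : ℝ)..(τ / 2), P.Dinv (P.D (ψ s)) := by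
    rw [coe_integral _ hφi, ← intervalIntegral.integral_add]
    · simp only [proj₀_add_Dinv]
    · exact hii ((P.X₀.subtypeL.comp P.proj₀).continuous.comp_continuousOn hψc)
    · exact hii ((P.Dinv.comp P.D).continuous.comp_continuousOn hψc)
  have hrep : w (τ / 2) - u (t + τ / 2) = (S (τ / 2) e : P.X₀)
      + ((duhamel S (fun s => P.proj₀ (ψ s)) (τ / 2)
          - ∫ s in (0 : ℝ)..(τ / 2), P.proj₀ (ψ s) : P.X₀) : X)
      - (∫ s in (0 : ℝ)..(τ / 2), P.Dinv (P.D (ψ s)))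
      + ∫ s in (0 : ℝ)..(τ / 2), (P.f (w s) - P.f (u (t + s))) := by
    have e1 : ∫ s in (0 : ℝ)..(τ / 2), (P.f (w s) - q s)
        = (∫ s in (0 : ℝ)..(τ / 2), (P.f (w s) - P.f (u (t + s))))
          - ∫ s in (0 : ℝ)..(τ / 2), ψ s := by
      rw [← intervalIntegral.integral_sub (hii hfg) (hii hψc)]
      refine intervalIntegral.integral_congr fun s _ => ?_
      simp only [hψ]; abel
    have e2 : w (τ / 2) - u (t + τ / 2) = (v (τ / 2) - u (t + τ / 2)) + (w (τ / 2) - w 0) := by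
      rw [hw0]; abel
    rw [e2, hv1, hftc, e1, hsplit]
    push_cast
    abel
  have b1 : ‖((S (τ / 2) e : P.X₀) : X)‖ ≤ K * ‖e‖ :=
    (S (τ / 2)).le_of_opNorm_le (h.norm_S _ (by linarith)) _
  have b2 : ‖((duhamel S (fun s => P.proj₀ (ψ s)) (τ / 2)
      - ∫ s in (0 : ℝ)..(τ / 2), P.proj₀ (ψ s) : P.X₀) : X)‖ ≤ K ^ 2 * τ ^ 2 := by
    change ‖duhamel S (fun s => P.proj₀ (ψ s)) (τ / 2)
      - ∫ s in (0 : ℝ)..(τ / 2), P.proj₀ (ψ s)‖ ≤ K ^ 2 * τ ^ 2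
    rw [duhamel, ← intervalIntegral.integral_sub (hS.intervalIntegrable_apply _ hφi) hφi]
    refine (intervalIntegral.norm_integral_le_of_norm_le_const (C := K * K * τ)
      fun s hs => ?_).trans ?_
    · rw [uIoc_of_le hm0] at hs
      obtain ⟨z, hz, hzK⟩ := hφA s ⟨hs.1.le, hs.2.trans hm⟩
      have := hS.norm_apply_sub_apply_le hB hz h.norm_S hzK (a := τ / 2 - s) (b := 0)
        (by linarith [hs.2]) (by linarith [hs.1]) le_rfl (by linarith [hr.1])
      rw [hS.map_zero_apply, sub_zero, abs_of_nonneg (by linarith [hs.2])] at this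
      refine this.trans ?_
      gcongr
      linarith [hs.1]
    · rw [sub_zero, abs_of_nonneg hm0]
      nlinarith [show 0 ≤ K ^ 2 * τ ^ 2 by positivity]
  have b3 : ‖∫ s in (0 : ℝ)..(τ / 2), P.Dinv (P.D (ψ s))‖ ≤ 2 * K ^ 3 * τ ^ 2 := by
    refine (intervalIntegral.norm_integral_le_of_norm_le_const (C := 3 * K ^ 3 * τ)
      fun s hs => ?_).trans ?_
    · rw [uIoc_of_le hm0] at hs
      exact hDψ s ⟨hs.1.le, hs.2.trans hm⟩
    · rw [sub_zero, abs_of_nonneg hm0]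
      nlinarith [show 0 ≤ K ^ 3 * τ ^ 2 by positivity]
  have b4 : ‖∫ s in (0 : ℝ)..(τ / 2), (P.f (w s) - P.f (u (t + s)))‖
      ≤ (K * ((2 * K + 1) * τ + (K * ‖e‖ + K ^ 3 * τ)) + K * τ) * τ := by
    refine (intervalIntegral.norm_integral_le_of_norm_le_const
      (C := K * ((2 * K + 1) * τ + (K * ‖e‖ + K ^ 3 * τ)) + K * τ) fun s hs => ?_).trans ?_
    · rw [uIoc_of_le hm0] at hs
      have hs' : s ∈ Icc 0 τ := ⟨hs.1.le, hs.2.trans hm⟩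
      have h1 := ((h.near _ hr _ (hball s hs').2).2.2 (u (t + τ / 2)) (by simpa using hδ.le)).1
      have h2 := h.norm_fu_sub_le (t + τ / 2) hr (t + s) ⟨by linarith [hs.1], by linarith [hs.2]⟩
      have h3 : ‖w s - u (t + τ / 2)‖ ≤ (2 * K + 1) * τ + (K * ‖e‖ + K ^ 3 * τ) := by
        have e3 : w s - u (t + τ / 2) = (w s - w 0) + (v (τ / 2) - u (t + τ / 2)) := by
          rw [hw0]; abel
        rw [e3]
        refine (norm_add_le _ _).trans (add_le_add ((hball s hs').1.trans ?_) hv2)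
        gcongr
        exact hs'.2
      have h4 : |t + τ / 2 - (t + s)| ≤ τ := abs_le.2 ⟨by linarith [hs.2], by linarith [hs.1]⟩
      have e4 : P.f (w s) - P.f (u (t + s)) = (P.f (w s) - P.f (u (t + τ / 2)))
          + (P.f (u (t + τ / 2)) - P.f (u (t + s))) := by abel
      rw [e4]
      refine (norm_add_le _ _).trans (add_le_add (h1.trans ?_) (h2.trans ?_)) <;> gcongr
    · rw [sub_zero, abs_of_nonneg hm0]
      gcongr
  have hea := norm_nonneg e
  have p1 : K ≤ K ^ 4 := le_self_pow₀ hK1 (by norm_num)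
  have p2 : K ^ 2 ≤ K ^ 4 := pow_le_pow_right₀ hK1 (by norm_num)
  have p3 : K ^ 3 ≤ K ^ 4 := pow_le_pow_right₀ hK1 (by norm_num)
  have p4 : K ^ 2 * ‖e‖ * τ ≤ K ^ 2 * ‖e‖ := mul_le_of_le_one_right (by positivity) hτ1
  have hτ2 : 0 ≤ τ ^ 2 := by positivity
  rw [hrep]
  refine (norm_add_le _ _).trans ((add_le_add ((_root_.norm_sub_le _ _).trans (add_le_add
    ((norm_add_le _ _).trans (add_le_add b1 b2)) b3)) b4).trans ?_)
  have q1 := mul_le_mul_of_nonneg_right p1 hea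
  have q2 := mul_le_mul_of_nonneg_right p2 hea
  have q3 := mul_le_mul_of_nonneg_right p1 hτ2
  have q4 := mul_le_mul_of_nonneg_right p2 hτ2
  have q5 := mul_le_mul_of_nonneg_right p3 hτ2
  have q6 : 0 ≤ K ^ 4 * ‖e‖ := by positivity
  nlinarith

/-- The error recursion of one step. The defect splits into the quadrature error `d` of the
correction terms, which is smoothed by the semigroup, and the rest `r`, which is of third order up
to a Lipschitz contribution of the previous error. -/
theorem error_recursion (h : P.UniformBounds u S g' δ K) (hδ : 0 < δ) (hP : P.Assumptions u)
    (hS : IsExtendedC0Semigroup S) (hB : IsGeneratorOf P.A₀ S)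
    (hq : P.IsCorrection u K τ t q) (hτ : 0 ≤ τ) (hτ1 : τ ≤ 1) (ht : 0 ≤ t) (hT : t + τ ≤ P.T)
    (hx : K * ‖P.proj₀ x - P.proj₀ (u t)‖ + (K ^ 3 + 2 * K + 1) * τ ≤ δ)
    (hy : P.IsStrangStep τ t q x y) :
    P.D y = P.D (u (t + τ)) ∧ ∃ d r : P.X₀,
      P.proj₀ y - P.proj₀ (u (t + τ)) = S τ (P.proj₀ x - P.proj₀ (u t)) + d + r ∧
      ‖d‖ ≤ 17 * K ^ 7 * τ ^ 2 ∧ (∀ s, 0 < s → s + τ ≤ P.T → ‖S s d‖ ≤ 17 * K ^ 7 * τ ^ 3 / s) ∧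
      ‖r‖ ≤ 17 * K ^ 7 * (τ * ‖P.proj₀ x - P.proj₀ (u t)‖ + τ ^ 3) := by
  obtain ⟨v, w, v', hv, hw0, hw, hv', rfl⟩ := hy
  have hK := h.pos
  have hK1 := h.one_le
  have hm0 : 0 ≤ τ / 2 := by positivity
  have hm : τ / 2 ≤ τ := by linarith
  have hr : t + τ / 2 ∈ Icc 0 P.T := ⟨by positivity, by linarith⟩
  have hmT := h.norm_midpoint_sub_le hδ hP hS hB hq hτ hτ1 ht hT hx hv hw0 hw
  obtain ⟨-, hφ2, hφA⟩ := h.proj₀_error hδ hq hτ ht hT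
  set e := P.proj₀ x - P.proj₀ (u t) with he
  set φ : ℝ → P.X₀ := fun s => P.proj₀ (q s - P.f (u (t + s))) with hφ
  have hqc := hq.contDiffOn.continuousOn
  have hgc : ContinuousOn (fun s => P.f (u (t + s))) (Icc 0 τ) := hP.continuousOn_f_comp ht hT
  have hψc : ContinuousOn (fun s => q s - P.f (u (t + s))) (Icc 0 τ) := hqc.sub hgc
  have hwc : ContinuousOn w (Icc 0 τ) := fun s hs => (hw s hs).continuousWithinAt
  have hfw : ContinuousOn (fun s => P.f (w s)) (Icc 0 τ) :=
    hP.f_diff.continuous.comp_continuousOn hwc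
  have hfg : ContinuousOn (fun s => P.f (w s) - P.f (u (t + s))) (Icc 0 τ) := hfw.sub hgc
  have hii : ∀ {k : ℝ → X}, ContinuousOn k (Icc 0 τ) →
      IntervalIntegrable k MeasureTheory.volume 0 τ := fun hk =>
    ContinuousOn.intervalIntegrable (by rwa [uIcc_of_le hτ])
  have hφi : IntervalIntegrable φ MeasureTheory.volume 0 τ :=
    intervalIntegrable_proj₀ (hii hψc)
  -- the two linear substeps
  obtain ⟨a1, -⟩ := hv.sub_eq hP hS hB ht hm0 (by linarith)
    (hqc.mono (Icc_subset_Icc_right hm))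
  simp only [← add_assoc t] at hv'
  obtain ⟨a2, a3⟩ := IsSolution.sub_eq (q := fun s => q (τ / 2 + s)) hP hS hB hr.1 hm0 (by linarith)
    (hqc.comp (by fun_prop) fun s hs => ⟨by linarith [hs.1], by linarith [hs.2]⟩) hv'
  have e0 : t + τ / 2 + τ / 2 = t + τ := by ring
  rw [e0] at a2 a3
  refine ⟨a3, ?_⟩
  -- the nonlinear substep
  have hftc : w τ - w 0 = ∫ s in (0 : ℝ)..τ, (P.f (w s) - q s) := by
    refine (intervalIntegral.integral_eq_sub_of_hasDeriv_right ?_ (fun s hs => ?_)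
      (hii (hfw.sub hqc))).symm
    · rwa [uIcc_of_le hτ]
    · rw [min_eq_left hτ, max_eq_right hτ] at hs
      exact (hw s ⟨hs.1.le, hs.2.le⟩).mono_of_mem_nhdsWithin
        (mem_of_superset (Icc_mem_nhdsGT hs.2) (Icc_subset_Icc_left hs.1.le))
  set J : X := ∫ s in (0 : ℝ)..τ, (P.f (w s) - P.f (u (t + s))) with hJ
  have hwτ : P.proj₀ (w τ) - P.proj₀ (u (t + τ / 2))
      = S (τ / 2) e + duhamel S φ (τ / 2) + (P.proj₀ J - ∫ s in (0 : ℝ)..τ, φ s) := by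
    have e1 : w τ - w 0 = J - ∫ s in (0 : ℝ)..τ, (q s - P.f (u (t + s))) := by
      rw [hftc, hJ, ← intervalIntegral.integral_sub (hii hfg) (hii hψc)]
      refine intervalIntegral.integral_congr fun s _ => ?_
      abel
    have e2 := congrArg P.proj₀ e1
    rw [map_sub, map_sub, proj₀_integral (hii hψc), hw0] at e2
    rw [← a1, ← e2]
    abel
  have hdu := hS.duhamel_add (h := φ) hm0 hm0 (by rwa [add_halves])
  rw [add_halves] at hdu
  obtain ⟨d1, d2⟩ := hS.norm_quadrature_error_le hB (M := 2 * K ^ 2) hτ (by linarith) h.norm_S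
    (by positivity) hK.le h.norm_S_sub (fun s hs => by
      obtain ⟨z, hz, hzK⟩ := hφA s hs
      exact ⟨z, hz, hzK.trans (by nlinarith)⟩) hφ2
  have p5 : K ^ 3 ≤ K ^ 7 := pow_le_pow_right₀ hK1 (by norm_num)
  refine ⟨duhamel S φ τ - S (τ / 2) (∫ s in (0 : ℝ)..τ, φ s), S (τ / 2) (P.proj₀ J), ?_, ?_, ?_, ?_⟩
  · rw [a2, hwτ, hdu]
    have e3 : S τ e = S (τ / 2) (S (τ / 2) e) := by
      rw [← hS.map_add_apply hm0 hm0, add_halves]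
    have e4 : duhamel S (fun s => P.proj₀ (q (τ / 2 + s) - P.f (u (t + τ / 2 + s)))) (τ / 2)
        = duhamel S (fun r => φ (τ / 2 + r)) (τ / 2) := by
      simp only [hφ, add_assoc]
    rw [e3, e4]
    simp only [map_add, map_sub]
    abel
  · refine d1.trans ?_
    have : K * (2 * K ^ 2) * τ ^ 2 = 2 * K ^ 3 * τ ^ 2 := by ring
    rw [this]
    gcongr
    norm_num
  · intro s hs hsT
    refine (d2 s hs hsT).trans ?_
    have : 2 * K * (2 * K ^ 2) * τ ^ 3 = 4 * K ^ 3 * τ ^ 3 := by ring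
    rw [this]
    gcongr
    norm_num
  · have hball := (h.nonlinear_step hP.f_diff hq hτ hr hw (by
      rw [hw0]; linarith [(h.first_substep hδ hP hS hB hq hτ ht hT hv).2]))
    have b1 := hball.2
    have b2 : ‖(∫ s in (0 : ℝ)..τ, P.f (u (t + s))) - τ • P.f (u (t + τ / 2))‖ ≤ K * τ ^ 3 := by
      have := norm_integral_sub_midpoint_le (g := fun s => P.f (u (t + s)))
        (g' := fun s => g' (t + s)) (L := K) hτ (fun s hs => by
          have hs' : t + s ∈ Icc 0 P.T := ⟨by linarith [hs.1], by linarith [hs.2]⟩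
          have h1 : HasDerivWithinAt (fun s : ℝ => t + s) 1 (Icc 0 τ) s :=
            (hasDerivWithinAt_id s _).const_add t
          have h2 := (h.deriv_fu _ hs').scomp s h1
            fun r hr => ⟨by linarith [hr.1], by linarith [hr.2]⟩
          rwa [one_smul] at h2) fun s hs r hr => by
          have h1 := h.norm_deriv_fu_sub (t + s) ⟨by linarith [hs.1], by linarith [hs.2]⟩
            (t + r) ⟨by linarith [hr.1], by linarith [hr.2]⟩
          rwa [add_sub_add_left_eq_sub] at h1
      rwa [abs_of_pos hK] at this
    have b3 : ‖P.f (w (τ / 2)) - P.f (u (t + τ / 2))‖ ≤ K * (9 * K ^ 4 * (‖e‖ + τ ^ 2)) :=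
      ((h.near _ hr _ (hball.1 _ ⟨hm0, hm⟩).2).2.2 (u (t + τ / 2))
        (by simpa using hδ.le)).1.trans (by gcongr)
    have hJb : ‖J‖ ≤ 17 * K ^ 5 * (τ * ‖e‖ + τ ^ 3) := by
      have e5 : J = ((∫ s in (0 : ℝ)..τ, P.f (w s)) - τ • P.f (w (τ / 2)))
          - ((∫ s in (0 : ℝ)..τ, P.f (u (t + s))) - τ • P.f (u (t + τ / 2)))
          + τ • (P.f (w (τ / 2)) - P.f (u (t + τ / 2))) := by
        rw [hJ, intervalIntegral.integral_sub (hii hfw) (hii hgc), smul_sub]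
        abel
      have b4 : ‖τ • (P.f (w (τ / 2)) - P.f (u (t + τ / 2)))‖
          ≤ τ * (K * (9 * K ^ 4 * (‖e‖ + τ ^ 2))) := by
        rw [norm_smul, Real.norm_of_nonneg hτ]; gcongr
      rw [e5]
      refine (norm_add_le _ _).trans ((add_le_add ((_root_.norm_sub_le _ _).trans
        (add_le_add b1 b2)) b4).trans ?_)
      have p1 : K * τ ^ 3 ≤ K ^ 5 * τ ^ 3 := by gcongr; exact le_self_pow₀ hK1 (by norm_num)
      have p2 : K ^ 3 * τ ^ 3 ≤ K ^ 5 * τ ^ 3 := by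
        gcongr
        norm_num
      have p3 : 0 ≤ K ^ 5 * (τ * ‖e‖) := by positivity
      linarith [show τ * (K * (9 * K ^ 4 * (‖e‖ + τ ^ 2)))
        = 9 * (K ^ 5 * (τ * ‖e‖)) + 9 * (K ^ 5 * τ ^ 3) by ring,
        show 17 * K ^ 5 * (τ * ‖e‖ + τ ^ 3) = 17 * (K ^ 5 * (τ * ‖e‖)) + 17 * (K ^ 5 * τ ^ 3) by
          ring]
    refine ((S (τ / 2)).le_of_opNorm_le_of_le (h.norm_S _ (by linarith))
      (P.proj₀.le_of_opNorm_le_of_le h.norm_proj₀ hJb)).trans (le_of_eq (by ring))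

end UniformBounds
end ConstrainedSystem

/-! ### Summation of the local errors -/

/-- The discrete Gronwall inequality in summed form. -/
theorem le_mul_exp_of_le_add_sum {a : ℕ → ℝ} {A b : ℝ} {n : ℕ} (hA : 0 ≤ A) (hb : 0 ≤ b)
    (h : ∀ m ≤ n, a m ≤ A + b * ∑ k ∈ Finset.range m, a k) :
    ∀ m ≤ n, a m ≤ A * Real.exp (b * m) := by
  have hpow : ∀ m ≤ n, A + b * ∑ k ∈ Finset.range m, a k ≤ A * (1 + b) ^ m := by
    intro m
    induction m with
    | zero => intro _; simp
    | succ m ih =>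
      intro hm
      have h1 := ih (by omega)
      have h2 := h m (by omega)
      rw [Finset.sum_range_succ, pow_succ]
      nlinarith
  intro m hm
  refine (h m hm).trans ((hpow m hm).trans ?_)
  rw [mul_comm b, Real.exp_nat_mul]
  gcongr
  linarith [Real.add_one_le_exp b]

namespace IsExtendedC0Semigroup

variable {E : Type*} [NormedAddCommGroup E] [NormedSpace ℝ E] {S : ℝ → E →L[ℝ] E}

/-- The solution formula for a linear recursion driven by a semigroup. -/
theorem eq_sum_of_recursion (hS : IsExtendedC0Semigroup S) {e b : ℕ → E} {τ : ℝ} {N : ℕ}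
    (hτ : 0 ≤ τ) (h0 : e 0 = 0) (h : ∀ n < N, e (n + 1) = S τ (e n) + b n) :
    ∀ n ≤ N, e n = ∑ k ∈ Finset.range n, S ((n - 1 - k : ℕ) * τ) (b k) := by
  intro n
  induction n with
  | zero => intro _; simpa using h0
  | succ n ih =>
    intro hn
    rw [h n (by omega), ih (by omega), Finset.sum_range_succ, map_sum]
    congr 1
    · refine Finset.sum_congr rfl fun k hk => ?_
      have hk' := Finset.mem_range.1 hk
      rw [← hS.map_add_apply hτ (by positivity)]
      have : n + 1 - 1 - k = (n - 1 - k) + 1 := by omega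
      rw [this]
      push_cast
      congr 2; ring
    · simp [hS.map_zero_apply]

/-- Summation of the local errors: the smoothed quadrature defects sum up to a harmonic series,
which is the source of the logarithm, and the remaining terms are controlled by Gronwall's
inequality. -/
theorem norm_le_of_recursion (hS : IsExtendedC0Semigroup S) {e d r : ℕ → E} {τ T K C : ℝ} {N : ℕ}
    (hτ : 0 < τ) (hN : N * τ ≤ T) (hK : ∀ t ≤ T, ‖S t‖ ≤ K) (hC : 0 ≤ C) (h0 : e 0 = 0)
    (h : ∀ n < N, e (n + 1) = S τ (e n) + d n + r n) (hd : ∀ n < N, ‖d n‖ ≤ C * τ ^ 2)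
    (hd' : ∀ n < N, ∀ s, 0 < s → s + τ ≤ T → ‖S s (d n)‖ ≤ C * τ ^ 3 / s)
    (hr : ∀ n < N, ‖r n‖ ≤ C * (τ * ‖e n‖ + τ ^ 3)) :
    ∀ n ≤ N, ‖e n‖ ≤ (2 * C * (1 + |Real.log T|) + K * C * T) * Real.exp (K * C * T)
      * (τ ^ 2 * (1 + |Real.log τ|)) := by
  have hT : 0 ≤ T := le_trans (by positivity) hN
  have hK0 : 0 ≤ K := (norm_nonneg _).trans (hK 0 hT)
  have hlogτ := abs_nonneg (Real.log τ)
  have hlogT := abs_nonneg (Real.log T)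
  have hnT : ∀ n ≤ N, n * τ ≤ T := fun n hn => le_trans (by gcongr) hN
  have hlog : ∀ n ≤ N, Real.log n ≤ |Real.log T| + |Real.log τ| := by
    intro n hn
    rcases Nat.eq_zero_or_pos n with rfl | hpos
    · simp only [Nat.cast_zero, Real.log_zero]; positivity
    · have hn0 : (0 : ℝ) < n := by exact_mod_cast hpos
      have h1 := Real.log_le_log (by positivity) (hnT n hn)
      rw [Real.log_mul hn0.ne' hτ.ne'] at h1
      linarith [le_abs_self (Real.log T), neg_abs_le (Real.log τ)]
  have hharm : ∀ n ≤ N, ∑ j ∈ Finset.range n, (2 * C * τ ^ 2) * ((j : ℝ) + 1)⁻¹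
      ≤ 2 * C * τ ^ 2 * (1 + (|Real.log T| + |Real.log τ|)) := by
    intro n hn
    rw [← Finset.mul_sum]
    have h1 := harmonic_le_one_add_log n
    rw [harmonic] at h1
    push_cast at h1
    gcongr
    exact h1.trans (by linarith [hlog n hn])
  have hsum := hS.eq_sum_of_recursion (b := fun n => d n + r n) hτ.le h0
    fun n hn => by rw [h n hn, add_assoc]
  set A := (2 * C * (1 + |Real.log T|) + K * C * T) * (τ ^ 2 * (1 + |Real.log τ|)) with hA
  have hA0 : 0 ≤ A := by positivity
  have hmain : ∀ n ≤ N, ‖e n‖ ≤ A + (K * C * τ) * ∑ k ∈ Finset.range n, ‖e k‖ := by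
    intro n hn
    rw [hsum n hn]
    have hterm : ∀ k ∈ Finset.range n, ‖S ((n - 1 - k : ℕ) * τ) (d k + r k)‖
        ≤ (2 * C * τ ^ 2) * (((n - 1 - k : ℕ) : ℝ) + 1)⁻¹
          + (K * C * τ * ‖e k‖ + K * C * τ ^ 3) := by
      intro k hk
      have hkn := Finset.mem_range.1 hk
      have hkN : k < N := hkn.trans_le hn
      have hjT : ((n - 1 - k : ℕ) : ℝ) * τ + τ ≤ T := by
        have h1 : ((n - 1 - k : ℕ) : ℝ) + 1 ≤ n := by
          have : n - 1 - k + 1 ≤ n := by omega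
          exact_mod_cast this
        calc ((n - 1 - k : ℕ) : ℝ) * τ + τ = (((n - 1 - k : ℕ) : ℝ) + 1) * τ := by ring
          _ ≤ n * τ := by gcongr
          _ ≤ T := hnT n hn
      set j := n - 1 - k
      rw [map_add]
      -- `1 / j ≤ 2 / (j + 1)` for `j ≥ 1`, so that the index `j = 0` needs no separate sum
      refine (norm_add_le _ _).trans (add_le_add ?_ ?_)
      · rcases Nat.eq_zero_or_pos j with hj | hj
        · rw [hj, Nat.cast_zero, zero_mul, hS.map_zero_apply, zero_add, inv_one, mul_one]
          exact (hd k hkN).trans (by nlinarith [show 0 ≤ C * τ ^ 2 by positivity])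
        · have hj1 : (1 : ℝ) ≤ j := by exact_mod_cast hj
          refine (hd' k hkN _ (by positivity) hjT).trans ?_
          rw [← div_eq_mul_inv, div_le_div_iff₀ (by positivity) (by positivity)]
          have : 0 ≤ C * τ ^ 3 * ((j : ℝ) - 1) := mul_nonneg (by positivity) (by linarith)
          linarith [show 2 * C * τ ^ 2 * (j * τ) - C * τ ^ 3 * (j + 1)
            = C * τ ^ 3 * ((j : ℝ) - 1) by ring]
      · exact ((S (j * τ)).le_of_opNorm_le_of_le (hK _ (by linarith)) (hr k hkN)).trans
          (le_of_eq (by ring))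
    refine (norm_sum_le_of_le _ hterm).trans ?_
    rw [Finset.sum_add_distrib, Finset.sum_add_distrib, ← Finset.mul_sum _ _ (K * C * τ),
      Finset.sum_range_reflect (fun j => (2 * C * τ ^ 2) * ((j : ℝ) + 1)⁻¹) n,
      Finset.sum_const, Finset.card_range, nsmul_eq_mul]
    have h1 := hharm n hn
    have h2 : n * (K * C * τ ^ 3) ≤ K * C * T * τ ^ 2 := by
      calc n * (K * C * τ ^ 3) = K * C * (n * τ) * τ ^ 2 := by ring
        _ ≤ K * C * T * τ ^ 2 := by gcongr; exact hnT n hn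
    have h3 : 2 * C * τ ^ 2 * (1 + (|Real.log T| + |Real.log τ|)) + K * C * T * τ ^ 2 ≤ A := by
      have h4 : 0 ≤ 2 * C * τ ^ 2 * (|Real.log T| * |Real.log τ|) := by positivity
      have h5 : 0 ≤ K * C * T * τ ^ 2 * |Real.log τ| := by positivity
      rw [hA]
      nlinarith
    linarith
  intro n hn
  refine (le_mul_exp_of_le_add_sum hA0 (by positivity) hmain n hn).trans ?_
  have h1 : K * C * τ * n ≤ K * C * T := by
    calc K * C * τ * n = K * C * (n * τ) := by ring
      _ ≤ _ := by gcongr; exact hnT n hn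
  calc A * Real.exp (K * C * τ * n) ≤ A * Real.exp (K * C * T) := by gcongr
    _ = _ := by rw [hA]; ring

end IsExtendedC0Semigroup

/-- Recursive choice, where the existence of the next step may depend on all the steps before. -/
theorem exists_sequence_of_step {α : Type*} (a : α) {R : ℕ → α → α → Prop} {N : ℕ}
    (h : ∀ U : ℕ → α, U 0 = a → ∀ n < N, (∀ k < n, R k (U k) (U (k + 1))) → ∃ y, R n (U n) y) :
    ∃ U : ℕ → α, U 0 = a ∧ ∀ n < N, R n (U n) (U (n + 1)) := by
  classical
  let U : ℕ → α := fun n => Nat.rec a (fun n x => if hx : ∃ y, R n x y then hx.choose else x) n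
  refine ⟨U, rfl, fun n => ?_⟩
  induction n using Nat.strong_induction_on with
  | _ n ih =>
    intro hn
    have hex := h U rfl n hn fun k hk => ih k hk (hk.trans hn)
    have e : U (n + 1) = hex.choose := dif_pos hex
    rw [e]
    exact hex.choose_spec

theorem sq_mul_one_add_abs_log_le {τ : ℝ} (hτ : 0 < τ) (hτ1 : τ ≤ 1) :
    τ ^ 2 * (1 + |Real.log τ|) ≤ 2 * τ := by
  have h := (Real.abs_log_mul_self_lt τ hτ hτ1).le
  rw [abs_mul, abs_of_pos hτ] at h
  nlinarith

namespace ConstrainedSystem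

variable {X Q : Type*} [NormedAddCommGroup X] [NormedSpace ℝ X] [CompleteSpace X]
  [NormedAddCommGroup Q] [NormedSpace ℝ Q] {P : ConstrainedSystem X Q} {u : ℝ → X}
  {S : ℝ → P.X₀ →L[ℝ] P.X₀} {g' : ℝ → X} {δ K : ℝ}

/-- Global error bound. The smallness condition that each step requires is recovered from the
bound itself, because `τ² (1 + |log τ|) ≤ 2 τ`. -/
theorem UniformBounds.convergence (h : P.UniformBounds u S g' δ K) (hδ : 0 < δ)
    (hP : P.Assumptions u) (hS : IsExtendedC0Semigroup S) (hB : IsGeneratorOf P.A₀ S) :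
    ∃ C τ₀ : ℝ, 0 < τ₀ ∧ ∀ τ : ℝ, 0 < τ → τ ≤ τ₀ → ∀ N : ℕ, N * τ ≤ P.T →
      ∀ q : ℕ → ℝ → X, (∀ n < N, P.IsCorrection u K τ (n * τ) (q n)) →
        ∀ U : ℕ → X, U 0 = P.u₀ → ∀ n ≤ N,
          (∀ k < n, P.IsStrangStep τ (k * τ) (q k) (U k) (U (k + 1))) →
          ‖u (n * τ) - U n‖ ≤ C * τ ^ 2 * (1 + |Real.log τ|) ∧
          (n < N → ∃ y, P.IsStrangStep τ (n * τ) (q n) (U n) y) := by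
  have hK := h.pos
  set C₁ := 17 * K ^ 7 with hC₁
  set C := (2 * C₁ * (1 + |Real.log P.T|) + K * C₁ * P.T) * Real.exp (K * C₁ * P.T) with hC
  have hTpos := hP.T_pos
  have hC₁0 : 0 ≤ C₁ := by positivity
  have hC0 : 0 ≤ C := by positivity
  -- with `‖e‖ ≤ 2 C τ` the smallness condition of a step reads `c τ ≤ δ`
  set c := 2 * K * C + K ^ 3 + 2 * K + 1 with hc
  have hc0 : 0 < c := by positivity
  refine ⟨C, min 1 (δ / c), by positivity, fun τ hτ hτ₀ N hN q hq U hU0 => ?_⟩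
  have hτ1 : τ ≤ 1 := hτ₀.trans (min_le_left _ _)
  have hτc : c * τ ≤ δ := by
    have := hτ₀.trans (min_le_right _ _)
    rwa [le_div_iff₀ hc0, mul_comm] at this
  set e : ℕ → P.X₀ := fun n => P.proj₀ (U n) - P.proj₀ (u (n * τ)) with he
  have hu0 := hP.u_zero hS hB
  have hstepT : ∀ n < N, n * τ + τ ≤ P.T := by
    intro n hn
    have h1 : (n : ℝ) + 1 ≤ N := by exact_mod_cast hn
    calc n * τ + τ = (n + 1) * τ := by ring
      _ ≤ N * τ := by gcongr
      _ ≤ P.T := hN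
  have hsmall : ∀ n, ‖e n‖ ≤ C * (τ ^ 2 * (1 + |Real.log τ|)) →
      K * ‖P.proj₀ (U n) - P.proj₀ (u (n * τ))‖ + (K ^ 3 + 2 * K + 1) * τ ≤ δ := by
    intro n hn
    have h1 : ‖e n‖ ≤ C * (2 * τ) :=
      hn.trans (mul_le_mul_of_nonneg_left (sq_mul_one_add_abs_log_le hτ hτ1) hC0)
    have h2 : K * ‖e n‖ ≤ K * (C * (2 * τ)) := by gcongr
    change K * ‖e n‖ + _ ≤ δ
    linarith [show c * τ = K * (C * (2 * τ)) + (K ^ 3 + 2 * K + 1) * τ by rw [hc]; ring]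
  have hbound : ∀ n ≤ N, (∀ k < n, P.IsStrangStep τ (k * τ) (q k) (U k) (U (k + 1))) →
      ‖e n‖ ≤ C * (τ ^ 2 * (1 + |Real.log τ|)) := by
    intro n
    induction n using Nat.strong_induction_on with
    | _ n ih =>
      intro hn hst
      have hrec : ∀ k < n, ∃ d r : P.X₀, e (k + 1) = S τ (e k) + d + r ∧
          ‖d‖ ≤ C₁ * τ ^ 2 ∧ (∀ s, 0 < s → s + τ ≤ P.T → ‖S s d‖ ≤ C₁ * τ ^ 3 / s) ∧
          ‖r‖ ≤ C₁ * (τ * ‖e k‖ + τ ^ 3) := by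
        intro k hk
        have hkN := hk.trans_le hn
        have hek := ih k hk hkN.le fun i hi => hst i (hi.trans hk)
        have h1 := (h.error_recursion hδ hP hS hB (hq k hkN) hτ.le hτ1 (by positivity)
          (hstepT k hkN) (hsmall k hek) (hst k hk)).2
        rw [show (k : ℝ) * τ + τ = (k + 1 : ℕ) * τ by push_cast; ring] at h1
        exact h1
      choose! d r h1 h2 h3 h4 using hrec
      have h0 : e 0 = 0 := by simp [he, hU0, hu0]
      exact hS.norm_le_of_recursion hτ (le_trans (by gcongr) hN) h.norm_S hC₁0 h0 h1 h2 h3 h4 n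
        le_rfl
  intro n hn hst
  have hen := hbound n hn hst
  refine ⟨?_, fun hnN => h.exists_strangStep hδ hP hS hB (hq n hnN) hτ.le (by positivity)
    (hstepT n hnN) (hsmall n hen)⟩
  have hD : P.D (U n) = P.D (u (n * τ)) := by
    cases n with
    | zero => simp [hU0, hu0]
    | succ k =>
      have hkN : k < N := hn
      have h1 := (h.error_recursion hδ hP hS hB (hq k hkN) hτ.le hτ1 (by positivity)
        (hstepT k hkN) (hsmall k (hbound k hkN.le fun i hi => hst i (by omega)))
        (hst k (by omega))).1
      rwa [show (k : ℝ) * τ + τ = (k + 1 : ℕ) * τ by push_cast; ring] at h1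
  rw [norm_sub_rev, ← P.coe_proj₀_sub hD, mul_assoc]
  exact hen

end ConstrainedSystem

end

theorem mainTheorem2 {X Q : Type*} [NormedAddCommGroup X] [NormedSpace ℝ X] [CompleteSpace X]
    [NormedAddCommGroup Q] [NormedSpace ℝ Q] [CompleteSpace Q]
    (P : ConstrainedSystem X Q) (u : ℝ → X) (hP : P.Assumptions u) (M : ℝ) :
    ∃ C τ₀ : ℝ, 0 < τ₀ ∧ ∀ τ : ℝ, 0 < τ → τ ≤ τ₀ → ∀ N : ℕ, N * τ ≤ P.T →
      ∀ q : ℕ → ℝ → X, (∀ n < N, P.IsCorrection u M τ (n * τ) (q n)) →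
        (∃ U : ℕ → X, P.IsStrangSplitting τ N q U) ∧
        ∀ U : ℕ → X, P.IsStrangSplitting τ N q U →
          ∀ n ≤ N, ‖u (n * τ) - U n‖ ≤ C * τ ^ 2 * (1 + |Real.log τ|) := by
  obtain ⟨S₀, hS₀, hB₀, hA₀⟩ := hP.A₀_generates
  have hS := hS₀.extend
  have hB := hB₀.extend
  have hA := hA₀.extend
  obtain ⟨g', δ, K, hδ, hMK, h⟩ := hP.exists_uniformBounds hS hA M
  obtain ⟨C, τ₀, hτ₀, hconv⟩ := h.convergence hδ hP hS hB
  refine ⟨C, τ₀, hτ₀, fun τ hτ hττ₀ N hN q hq => ?_⟩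
  have hmain := hconv τ hτ hττ₀ N hN q fun n hn => (hq n hn).mono hτ.le hMK
  exact ⟨exists_sequence_of_step P.u₀ fun U hU0 n hn hst => (hmain U hU0 n hn.le hst).2 hn,
    fun U hU n hn => (hmain U hU.1 n hn fun k hk => hU.2 k (hk.trans_le hn)).1⟩
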